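/- Let $p,q\in\mathbb C$ with $0<|p|<1$ and $0<|q|<1$, and fix a square root $q^{1/2}$ of $q$ (powers $q^{k/2}$, $q^{k(k-1)/4}$ with integer $k$ mean the corresponding integer powers of $q^{1/2}$). For $x\ne0$ put $\theta(x;p)=\prod_{j\ge0}(1-p^jx)(1-p^{j+1}/x)$, $(x;q,p)_k=\prod_{j=0}^{k-1}\theta(xq^j;p)$ for integers $k\ge 0$, and write $\theta(x_1,\dots,x_r;p)=\prod_l\theta(x_l;p)$, $(x_1,\dots,x_r;q,p)_k=\prod_l(x_l;q,p)_k$. Let $\mathbf n=(n_1,\dots,n_m)$ be nonnegative integers and let $\mathbf c=(c_1,\dots,c_m)$, $\mathbf a=(a_1,\dots,a_m)$ be tuples of nonzero complex numbers. Let $W_{\mathbf c}^{\mathbf n}$ be the complex span of all functions $$\frac{g(z_1,\dots,z_m)}{\prod_{i=1}^m(c_iz_i,c_i/z_i;q,p)_{k_i}},\qquad 0\le k_i\le n_i,$$ where $g$ is holomorphic for $z_1,\dots,z_m\ne0$, symmetric in $z_i$ and $1/z_i$ for each $i$, and satisfies $g(z_1,\dots,pz_i,\dots,z_m)=p^{-k_i}z_i^{-2k_i}g(z_1,\dots,z_m)$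 for each $i$. Define $$\mathcal D_{c,q,p;z_i}f(\mathbf z)=2q^{1/2}z_i\frac{\theta(cz_iq^{-1/2},cz_iq^{1/2},cq^{-1/2}/z_i,cq^{1/2}/z_i;p)}{\theta(q,z_i^2;p)}\bigl(f(\dots,q^{1/2}z_i,\dots)-f(\dots,q^{-1/2}z_i,\dots)\bigr),$$ $\mathcal D^{(0)}_{c,q,p;z_i}=\mathrm{id}$, $\mathcal D^{(k+1)}_{c,q,p;z_i}=\mathcal D_{cq^{3k/2},q,p;z_i}\mathcal D^{(k)}_{c,q,p;z_i}$, and $\mathcal D^{(\mathbf k)}_{\mathbf c,q,p;\mathbf z}=\mathcal D^{(k_1)}_{c_1,q,p;z_1}\cdots\mathcal D^{(k_m)}_{c_m,q,p;z_m}$. Assume that $(q;q,p)_{k}$, $(c_i/a_i;q,p)_{k}$ and $(a_ic_iq^{k-1};q,p)_{k}$ are nonzero for all $i$ and all $0\le k\le n_i$. Let $f\in W_{\mathbf c}^{\mathbf n}$. Then for each $\mathbf k$ with $0\le k_i\le n_i$ the meromorphic function $\mathcal D^{(\mathbf k)}_{\mathbf c,q,p;\mathbf z}f$ is regular (after removing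 removable singularities) at the point $z_i=a_iq^{k_i/2}$, $i=1,\dots,m$, and $$f(z_1,\dots,z_m)=\sum_{k_1=0}^{n_1}\cdots\sum_{k_m=0}^{n_m}f_{k_1,\dots,k_m}\prod_{i=1}^m\frac{(a_iz_i,a_i/z_i;q,p)_{k_i}}{(c_iz_i,c_i/z_i;q,p)_{k_i}}$$ for all $z_1,\dots,z_m\ne0$ with $(c_iz_i,c_i/z_i;q,p)_{n_i}\neq0$ for every $i$, where $$f_{k_1,\dots,k_m}=\prod_{i=1}^m\frac{(-1)^{k_i}q^{-k_i(k_i-1)/4}\,\theta(q;p)^{k_i}}{(2a_i)^{k_i}(q,c_i/a_i,a_ic_iq^{k_i-1};q,p)_{k_i}}\;\bigl[\mathcal D^{(\mathbf k)}_{\mathbf c,q,p;\mathbf z}f(\mathbf z)\bigr]_{z_i=a_iq^{k_i/2},\ i=1,\dots,m}.$$ -/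

import Mathlib

open Topology Filter

noncomputable section

namespace EllipticTaylor

/-- The modified Jacobi theta function `θ(x;p) = ∏_{j ≥ 0} (1 - p^j x)(1 - p^{j+1}/x)`
(for `x ≠ 0`, `|p| < 1`). -/
def theta (p x : ℂ) : ℂ :=
  ∏' j : ℕ, ((1 - p ^ j * x) * (1 - p ^ (j + 1) / x))

/-- The theta shifted factorial `(x;q,p)_n` for `n = 0, 1, 2, …`. -/
def thetaFac (q p x : ℂ) (n : ℕ) : ℂ :=
  ∏ k ∈ Finset.range n, theta p (x * q ^ k)

/-- `(x z, x / z; q, p)_n`. -/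
def thetaFac₂ (q p x z : ℂ) (n : ℕ) : ℂ :=
  thetaFac q p (x * z) n * thetaFac q p (x / z) n

/-- `g` is holomorphic for `z_1, …, z_m ≠ 0`, symmetric in `z_i` and `1 / z_i` for each `i`, and
`g(z_1, …, p z_i, …, z_m) = p^{-k_i} z_i^{-2 k_i} g(z_1, …, z_m)` for each `i`. -/
structure IsThetaFunction {m : ℕ} (p : ℂ) (k : Fin m → ℕ) (g : (Fin m → ℂ) → ℂ) : Prop where
  holomorphic : DifferentiableOn ℂ g {z | ∀ i, z i ≠ 0}
  symmetric : ∀ z : Fin m → ℂ, (∀ i, z i ≠ 0) → ∀ i,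
    g (Function.update z i (z i)⁻¹) = g z
  quasiPeriodic : ∀ z : Fin m → ℂ, (∀ i, z i ≠ 0) → ∀ i,
    g (Function.update z i (p * z i)) = 1 / (p ^ k i * z i ^ (2 * k i)) * g z

/-- The space `W_{c_1, …, c_m}^{n_1, …, n_m}`: the complex span of the quotients
`g(z_1, …, z_m) / ∏_i (c_i z_i, c_i / z_i; q, p)_{k_i}` with `0 ≤ k_i ≤ n_i`, where `g` runs over
all functions as in `IsThetaFunction` of multidegree `k`. Elements are represented by honest
functions; their values at points with some `z_i = 0`, or at zeros of the denominators,
are irrelevant. -/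
def W {m : ℕ} (q p : ℂ) (c : Fin m → ℂ) (n : Fin m → ℕ) : Submodule ℂ ((Fin m → ℂ) → ℂ) :=
  Submodule.span ℂ {f | ∃ k : Fin m → ℕ, (∀ i, k i ≤ n i) ∧
    ∃ g : (Fin m → ℂ) → ℂ, IsThetaFunction p k g ∧
      f = fun z => g z / ∏ i, thetaFac₂ q p (c i) (z i) (k i)}

/-- The partial elliptic Askey–Wilson operator `𝓓_{c,q,p;z_i}`, where `s = q^{1/2}`
and `q = s ^ 2`. -/
def awOp {m : ℕ} (s p c : ℂ) (i : Fin m) (f : (Fin m → ℂ) → ℂ) : (Fin m → ℂ) → ℂ :=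
  fun z =>
    2 * s * z i *
      (theta p (c * z i * s⁻¹) * theta p (c * z i * s) *
        theta p (c * s⁻¹ / z i) * theta p (c * s / z i)) /
      (theta p (s ^ 2) * theta p (z i ^ 2)) *
      (f (Function.update z i (s * z i)) - f (Function.update z i (s⁻¹ * z i)))

/-- The iterates: `𝓓^{(0)} = id` and
`𝓓_{c,q,p;z_i}^{(k+1)} = 𝓓_{c q^{3k/2},q,p;z_i} 𝓓_{c,q,p;z_i}^{(k)}`. -/
def awIter {m : ℕ} (s p c : ℂ) (i : Fin m) : ℕ → ((Fin m → ℂ) → ℂ) → ((Fin m → ℂ) → ℂ)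
  | 0, f => f
  | k + 1, f => awOp s p (c * s ^ (3 * k)) i (awIter s p c i k f)

/-- The composition `𝓓_{c_1,q,p;z_1}^{(k_1)} ⋯ 𝓓_{c_m,q,p;z_m}^{(k_m)}` applied to `f`. -/
def awMulti {m : ℕ} (s p : ℂ) (c : Fin m → ℂ) (k : Fin m → ℕ) (f : (Fin m → ℂ) → ℂ) :
    (Fin m → ℂ) → ℂ :=
  (List.finRange m).foldr (fun i F => awIter s p (c i) i (k i) F) f

/-- `F`, regarded as a meromorphic function (so that only its values on a dense open set matter),
is regular at `w` and has the value `v` there. This is how `[F(z)]_{z = w}` has to be read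
for `F = 𝓓^{(k)} f`: the factors `1 / θ(z_i²;p)` in the operators may produce removable
singularities at `w`. -/
def HasRegularValue {m : ℕ} (F : (Fin m → ℂ) → ℂ) (w : Fin m → ℂ) (v : ℂ) : Prop :=
  ∃ G : (Fin m → ℂ) → ℂ, AnalyticAt ℂ G w ∧ G w = v ∧
    ∃ U : Set (Fin m → ℂ), IsOpen U ∧ Dense U ∧ ∀ᶠ z in 𝓝 w, z ∈ U → F z = G z

/-- The regular value is unique. -/
theorem HasRegularValue.unique {m : ℕ} {F : (Fin m → ℂ) → ℂ} {w : Fin m → ℂ} {v v' : ℂ}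
    (h : HasRegularValue F w v) (h' : HasRegularValue F w v') : v = v' := by
  obtain ⟨G, hG, rfl, U, hU, hUd, hFG⟩ := h
  obtain ⟨G', hG', rfl, U', hU', hUd', hFG'⟩ := h'
  have hd : Dense (U ∩ U') := hUd.inter_of_isOpen_left hUd' hU
  have hfr : ∃ᶠ z in 𝓝 w, z ∈ U ∩ U' := mem_closure_iff_frequently.1 (hd w)
  refine tendsto_nhds_unique_of_frequently_eq hG.continuousAt hG'.continuousAt ?_
  refine (hfr.and_eventually (hFG.and hFG')).mono ?_
  rintro z ⟨hz, h1, h2⟩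
  exact (h1 hz.1).symm.trans (h2 hz.2)

/-- The one-variable factor
`(-1)^k q^{-k(k-1)/4} θ(q;p)^k / ((2a)^k (q, c/a, a c q^{k-1}; q, p)_k)` of the Taylor
coefficients, where `s = q^{1/2}`; note `q^{k(k-1)/4} = s^{k(k-1)/2}`, with the integer exponent
`k(k-1)/2 = k.choose 2`. -/
def taylorFactor (s p a c : ℂ) (k : ℕ) : ℂ :=
  (-1) ^ k * (s ^ (k.choose 2))⁻¹ * theta p (s ^ 2) ^ k /
    ((2 * a) ^ k * (thetaFac (s ^ 2) p (s ^ 2) k * thetaFac (s ^ 2) p (c / a) k *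
      thetaFac (s ^ 2) p (a * c * (s ^ 2) ^ ((k : ℤ) - 1)) k))

end EllipticTaylor

end

/-! In one variable, the Laurent coefficients of a theta function of degree $n$ are linked by
$k\mapsto-k$ (symmetry) and $k\mapsto k+2n$ (quasi-periodicity). Those with $0\le k\le n$ therefore
determine the function (`laurent_eq_zero`), and any $n+1$ independent theta functions of degree $n$
span all of them (`IsThetaOne.exists_eq_sum`). The products $(az,a/z)_k(cq^kz,cq^k/z)_{n-k}$ are
independent by a triangular argument (`thetaBasis_independent`). Divided by $(cz,c/z)_n$ they become
the ratios $(az,a/z)_k/(cz,c/z)_k$. Expanding one variable after another writes $f$ as a combination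
of products of such ratios, with unknown coefficients $\beta_K$ (`exists_expansion_of_mem_W`).

The operators identify $\beta_K$. By Weierstrass's addition formula, $\mathcal D_c$ sends the ratio
of order $j+1$ with parameters $(a,c)$ to a multiple of the ratio of order $j$ with parameters
$(aq^{1/2},cq^{3/2})$ (`awOne_thetaRatio`); this explains the shift of $c$ in the iterates. After
$k$ steps, ratios of order below $k$ are killed, the one of order $k$ is a constant, and those of
higher order vanish at $z=aq^{k/2}$ because $\theta(1;p)=0$. Evaluation there isolates $\beta_k$
times the inverse Taylor factor. In several variables the operators act factor by factor on
products. Poles are avoided by working on open dense sets. -/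

open scoped Real

namespace EllipticTaylor

/-! ### Infinite products and the theta function -/

/-- The infinite product `(x; p)_∞ = ∏_{j ≥ 0} (1 - p^j x)`. -/
noncomputable def qPoch (p x : ℂ) : ℂ := ∏' j : ℕ, (1 - p ^ j * x)

theorem summable_norm_pow_mul {p : ℂ} (hp1 : ‖p‖ < 1) (x : ℂ) :
    Summable fun j : ℕ => ‖-(p ^ j * x)‖ := by
  simpa using (summable_geometric_of_lt_one (norm_nonneg _) hp1).mul_right ‖x‖

theorem multipliable_qPoch {p : ℂ} (hp1 : ‖p‖ < 1) (x : ℂ) :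
    Multipliable fun j : ℕ => (1 - p ^ j * x) := by
  simpa [sub_eq_add_neg] using multipliable_one_add_of_summable (summable_norm_pow_mul hp1 x)

theorem qPoch_eq {p : ℂ} (hp1 : ‖p‖ < 1) (x : ℂ) :
    qPoch p x = (1 - x) * qPoch p (p * x) := by
  have e : (fun j : ℕ => 1 - p ^ (j + 1) * x) = fun j => 1 - p ^ j * (p * x) := by
    funext j; ring
  have h : Multipliable fun j : ℕ => (1 - p ^ (j + 1) * x) := by
    rw [e]; exact multipliable_qPoch hp1 (p * x)
  have h1 : qPoch p x = (1 - p ^ 0 * x) * ∏' j : ℕ, (1 - p ^ (j + 1) * x) :=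
    tprod_eq_zero_mul' h
  rw [h1, e, pow_zero, one_mul, qPoch]

theorem qPoch_ne_zero {p : ℂ} (hp1 : ‖p‖ < 1) {x : ℂ} (hx : ‖x‖ < 1) : qPoch p x ≠ 0 := by
  have := tprod_one_add_ne_zero_of_summable (f := fun j : ℕ => -(p ^ j * x)) (fun j h => ?_)
    (summable_norm_pow_mul hp1 x)
  · simpa [qPoch, sub_eq_add_neg] using this
  · have h1 : p ^ j * x = 1 := by linear_combination -h
    have h2 : ‖p ^ j * x‖ < 1 := by
      rw [norm_mul, norm_pow]
      calc ‖p‖ ^ j * ‖x‖ ≤ 1 * ‖x‖ := by gcongr; exact pow_le_one₀ (norm_nonneg _) hp1.le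
        _ < 1 := by simpa using hx
    simp [h1] at h2

theorem differentiable_qPoch {p : ℂ} (hp1 : ‖p‖ < 1) : Differentiable ℂ (qPoch p) := by
  intro x
  have h : HasProdLocallyUniformlyOn (fun (j : ℕ) (y : ℂ) => 1 + -(p ^ j * y))
      (fun y => ∏' j : ℕ, (1 + -(p ^ j * y))) (Metric.ball (0 : ℂ) (‖x‖ + 1)) := by
    refine Summable.hasProdLocallyUniformlyOn_nat_one_add Metric.isOpen_ball
      (u := fun j => ‖p‖ ^ j * (‖x‖ + 1))
      ((summable_geometric_of_lt_one (norm_nonneg _) hp1).mul_right _)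
      (.of_forall fun n y hy => ?_) fun n => by fun_prop
    simp only [norm_neg, norm_mul, norm_pow]
    gcongr
    simpa using (Metric.mem_ball.1 hy).le
  have h2 := h.differentiableOn
    (.of_forall fun _ => by
      simpa [Finset.prod_fn] using DifferentiableOn.finsetProd (fun _ _ => by fun_prop))
    Metric.isOpen_ball
  have h3 := h2.differentiableAt (Metric.isOpen_ball.mem_nhds (by simp : x ∈ _))
  simpa [← sub_eq_add_neg] using! h3

theorem theta_eq {p : ℂ} (hp1 : ‖p‖ < 1) (x : ℂ) :
    theta p x = qPoch p x * qPoch p (p / x) := by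
  rw [qPoch, qPoch, ← (multipliable_qPoch hp1 _).tprod_mul (multipliable_qPoch hp1 _), theta]
  congr 1; ext j; rw [pow_succ]; ring

theorem theta_inv {p : ℂ} (hp1 : ‖p‖ < 1) {x : ℂ} (hx : x ≠ 0) :
    theta p x⁻¹ = -x⁻¹ * theta p x := by
  rw [theta_eq hp1, theta_eq hp1, qPoch_eq hp1 x, qPoch_eq hp1 x⁻¹]
  rw [div_inv_eq_mul, ← div_eq_mul_inv]
  field_simp
  ring

theorem theta_mul_p {p : ℂ} (hp0 : p ≠ 0) (hp1 : ‖p‖ < 1) {x : ℂ} (hx : x ≠ 0) :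
    theta p (p * x) = -x⁻¹ * theta p x := by
  rw [← theta_inv hp1 hx, theta_eq hp1, theta_eq hp1, div_inv_eq_mul, mul_comm]
  congr 2
  field_simp

theorem theta_one {p : ℂ} (hp1 : ‖p‖ < 1) : theta p 1 = 0 := by
  rw [theta_eq hp1, qPoch_eq hp1]; simp

theorem theta_ne_zero {p : ℂ} {x : ℂ} (hpx : ‖p‖ < ‖x‖) (hx : ‖x‖ < 1) : theta p x ≠ 0 := by
  have hx0 : 0 < ‖x‖ := (norm_nonneg _).trans_lt hpx
  rw [theta_eq (hpx.trans hx)]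
  refine mul_ne_zero (qPoch_ne_zero (hpx.trans hx) hx) (qPoch_ne_zero (hpx.trans hx) ?_)
  rwa [norm_div, div_lt_one hx0]

theorem exists_theta_ne_zero {p : ℂ} (hp1 : ‖p‖ < 1) : ∃ x : ℂ, x ≠ 0 ∧ theta p x ≠ 0 := by
  obtain ⟨r, hr, hr1⟩ := exists_between hp1
  have hr0 : 0 < r := (norm_nonneg _).trans_lt hr
  have hn : ‖(r : ℂ)‖ = r := by simp [abs_of_pos hr0]
  exact ⟨r, by exact_mod_cast hr0.ne', theta_ne_zero (by rwa [hn]) (by rwa [hn])⟩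

theorem differentiableAt_theta {p : ℂ} (hp1 : ‖p‖ < 1) {x : ℂ} (hx : x ≠ 0) :
    DifferentiableAt ℂ (theta p) x := by
  have : theta p = fun y => qPoch p y * qPoch p (p / y) := funext (theta_eq hp1)
  rw [this]
  exact (differentiable_qPoch hp1 x).mul
    ((differentiable_qPoch hp1 (p / x)).comp x (by fun_prop (disch := exact hx)))

theorem differentiableOn_theta {p : ℂ} (hp1 : ‖p‖ < 1) :
    DifferentiableOn ℂ (theta p) {0}ᶜ :=
  fun _ hx => (differentiableAt_theta hp1 hx).differentiableWithinAt

/-! ### Generic points -/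

/-- Open and dense subsets. -/
def OpenDense {X : Type*} [TopologicalSpace X] (E : Set X) : Prop := IsOpen E ∧ Dense E

theorem OpenDense.inter {X : Type*} [TopologicalSpace X] {E F : Set X} (hE : OpenDense E)
    (hF : OpenDense F) : OpenDense (E ∩ F) :=
  ⟨hE.1.inter hF.1, hE.2.inter_of_isOpen_left hF.2 hE.1⟩

theorem OpenDense.preimage_mul {E : Set ℂ} (hE : OpenDense E) {s : ℂ} (hs : s ≠ 0) :
    OpenDense {t | s * t ∈ E} :=
  ⟨hE.1.preimage (by fun_prop), hE.2.preimage (Homeomorph.mulLeft₀ s hs).isOpenMap⟩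

theorem OpenDense.pi {ι : Type*} [Finite ι] {X : Type*} [TopologicalSpace X] {E : ι → Set X}
    (hE : ∀ i, OpenDense (E i)) : OpenDense {z : ι → X | ∀ i, z i ∈ E i} := by
  have : {z : ι → X | ∀ i, z i ∈ E i} = Set.univ.pi E := by ext; simp
  rw [this]
  exact ⟨isOpen_set_pi Set.finite_univ fun i _ => (hE i).1,
    dense_pi _ fun i _ => (hE i).2⟩

theorem openDense_univ {X : Type*} [TopologicalSpace X] : OpenDense (Set.univ : Set X) :=
  ⟨isOpen_univ, dense_univ⟩

theorem isPreconnected_compl_zero : IsPreconnected ({0}ᶜ : Set ℂ) :=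
  (isConnected_compl_singleton_of_one_lt_rank (by simp) 0).isPreconnected

/-- If the zeros filled an open set, the identity theorem on the connected set $\mathbb
C\setminus\{0\}$ would force $F=0$. -/
theorem openDense_ne_zero_of_differentiableOn {F : ℂ → ℂ} (hF : DifferentiableOn ℂ F {0}ᶜ)
    {x : ℂ} (hx : x ≠ 0) (hFx : F x ≠ 0) : OpenDense {t | t ≠ 0 ∧ F t ≠ 0} := by
  have ho : IsOpen ({0}ᶜ : Set ℂ) := isOpen_compl_singleton
  refine ⟨?_, fun t => ?_⟩
  · have := hF.continuousOn.isOpen_inter_preimage ho (isOpen_compl_singleton (x := (0 : ℂ)))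
    exact this
  · rw [mem_closure_iff_frequently]
    intro hc
    have hd : Dense ({0}ᶜ : Set ℂ) := dense_compl_singleton 0
    obtain ⟨V, hV, hVo, htV⟩ := eventually_nhds_iff.1 hc
    obtain ⟨y, hyV, hy⟩ := hd.inter_open_nonempty V hVo ⟨t, htV⟩ |>.imp fun _ h => h
    have hz : F =ᶠ[𝓝 y] 0 := by
      filter_upwards [hVo.mem_nhds hyV, ho.mem_nhds hy] with u hu hu0
      by_contra hne
      exact hV u hu ⟨hu0, hne⟩
    exact hFx ((hF.analyticOnNhd ho).eqOn_zero_of_preconnected_of_eventuallyEq_zero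
      isPreconnected_compl_zero hy hz hx)

theorem openDense_theta_mul {p : ℂ} (hp1 : ‖p‖ < 1) {α : ℂ} (hα : α ≠ 0) :
    OpenDense {t | t ≠ 0 ∧ theta p (α * t) ≠ 0} := by
  obtain ⟨x, hx, hx'⟩ := exists_theta_ne_zero hp1
  refine openDense_ne_zero_of_differentiableOn (F := fun t => theta p (α * t)) ?_
    (x := x / α) (div_ne_zero hx hα) (by rwa [mul_div_cancel₀ _ hα])
  exact (differentiableOn_theta hp1).comp (by fun_prop) fun t ht => mul_ne_zero hα ht

theorem openDense_theta_div {p : ℂ} (hp1 : ‖p‖ < 1) {α : ℂ} (hα : α ≠ 0) :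
    OpenDense {t | t ≠ 0 ∧ theta p (α / t) ≠ 0} := by
  obtain ⟨x, hx, hx'⟩ := exists_theta_ne_zero hp1
  refine openDense_ne_zero_of_differentiableOn (F := fun t => theta p (α / t)) ?_
    (x := α / x) (div_ne_zero hα hx) (by rwa [div_div_cancel₀ hα])
  refine (differentiableOn_theta hp1).comp ?_ fun t ht => div_ne_zero hα ht
  intro t ht
  have : t ≠ 0 := ht
  exact ((differentiableAt_const α).div differentiableAt_id this).differentiableWithinAt

theorem openDense_theta_sq {p : ℂ} (hp1 : ‖p‖ < 1) :
    OpenDense {t | t ≠ 0 ∧ theta p (t ^ 2) ≠ 0} := by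
  obtain ⟨x, hx, hx'⟩ := exists_theta_ne_zero hp1
  obtain ⟨r, rfl⟩ := IsAlgClosed.exists_pow_nat_eq x two_pos
  refine openDense_ne_zero_of_differentiableOn (F := fun t => theta p (t ^ 2)) ?_
    (x := r) (by rintro rfl; simp at hx) hx'
  exact (differentiableOn_theta hp1).comp (by fun_prop) fun t ht => pow_ne_zero 2 ht

theorem OpenDense.eqOn_of_continuousOn {E : Set ℂ} (hE : OpenDense E) {F G : ℂ → ℂ}
    (hF : ContinuousOn F {0}ᶜ) (hG : ContinuousOn G {0}ᶜ)
    (h : ∀ t ∈ E, t ≠ 0 → F t = G t) {t : ℂ} (ht : t ≠ 0) : F t = G t := by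
  have ho : IsOpen ({0}ᶜ : Set ℂ) := isOpen_compl_singleton
  have hfr : ∃ᶠ u in 𝓝 t, u ∈ E := mem_closure_iff_frequently.1 (hE.2 t)
  refine tendsto_nhds_unique_of_frequently_eq (hF.continuousAt (ho.mem_nhds ht))
    (hG.continuousAt (ho.mem_nhds ht)) ?_
  exact (hfr.and_eventually (ho.mem_nhds ht)).mono fun u hu => h u hu.1 hu.2

/-! ### Laurent coefficients of one-variable theta functions -/

/-- One-variable symmetric theta functions of degree `n`. -/
structure IsThetaOne (p : ℂ) (n : ℕ) (h : ℂ → ℂ) : Prop where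
  holomorphic : DifferentiableOn ℂ h {0}ᶜ
  symmetric : ∀ z, z ≠ 0 → h z⁻¹ = h z
  quasiPeriodic : ∀ z, z ≠ 0 → h (p * z) = 1 / (p ^ n * z ^ (2 * n)) * h z

/-- Since $p$ may be complex, $z\mapsto pz$ also rotates the circle by $\arg p$; periodicity of the
integrand absorbs the rotation. -/
theorem circleIntegral_norm_eq_smul (p : ℂ) (F : ℂ → ℂ) :
    (∮ z in C(0, ‖p‖), F z) = p * ∮ z in C(0, 1), F (p * z) := by
  have hmap : ∀ θ : ℝ, p * circleMap 0 1 θ = circleMap 0 ‖p‖ (θ + p.arg) := by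
    intro θ
    conv_lhs => rw [← Complex.norm_mul_exp_arg_mul_I p]
    simp only [circleMap, zero_add, Complex.ofReal_one, one_mul, Complex.ofReal_add, add_mul,
      Complex.exp_add]
    ring
  have hper : Function.Periodic
      (fun θ : ℝ => deriv (circleMap 0 ‖p‖) θ • F (circleMap 0 ‖p‖ θ)) (2 * π) := by
    intro θ
    simp only [deriv_circleMap, periodic_circleMap 0 ‖p‖ θ]
  rw [circleIntegral, circleIntegral, ← intervalIntegral.integral_const_mul]
  have h1 := hper.intervalIntegral_add_eq 0 p.arg
  rw [zero_add] at h1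
  rw [h1]
  have h2 := intervalIntegral.integral_comp_add_right (a := 0) (b := 2 * π)
    (fun θ : ℝ => deriv (circleMap 0 ‖p‖) θ • F (circleMap 0 ‖p‖ θ)) p.arg
  rw [zero_add, add_comm (2 * π)] at h2
  rw [← h2]
  refine intervalIntegral.integral_congr fun θ _ => ?_
  simp only [deriv_circleMap, smul_eq_mul, ← hmap]
  have h3 : circleMap 0 ‖p‖ (θ + p.arg) = p * circleMap 0 1 θ := (hmap θ).symm
  simp only [circleMap, zero_add, Complex.ofReal_one, one_mul] at h3 ⊢
  ring

/-- `2 π i` times the `k`-th Laurent coefficient. -/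
noncomputable def laurent (h : ℂ → ℂ) (k : ℤ) : ℂ := ∮ z in C(0, 1), z ^ (-k - 1) * h z

theorem laurent_neg {h : ℂ → ℂ} (hs : ∀ z, z ≠ 0 → h z⁻¹ = h z) (k : ℤ) :
    laurent h (-k) = laurent h k := by
  have key : ∀ (k : ℤ) (θ : ℝ), deriv (circleMap 0 1) θ •
      ((circleMap 0 1 θ) ^ (-k - 1) * h (circleMap 0 1 θ)) =
      Complex.I * ((circleMap 0 1 θ) ^ (-k) * h (circleMap 0 1 θ)) := by
    intro k θ
    have h0 : circleMap 0 1 θ ≠ 0 := circleMap_ne_center one_ne_zero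
    rw [deriv_circleMap, zpow_sub_one₀ h0, smul_eq_mul]
    field_simp
  simp only [laurent, circleIntegral, key]
  have hper : Function.Periodic (fun θ : ℝ => Complex.I *
      ((circleMap 0 1 θ) ^ (- -k) * h (circleMap 0 1 θ))) (2 * π) := by
    intro θ
    simp only [periodic_circleMap 0 1 θ]
  have h1 := hper.intervalIntegral_add_eq 0 (-(2 * π))
  rw [zero_add, neg_add_cancel] at h1
  rw [h1]
  have h2 := intervalIntegral.integral_comp_neg (a := 0) (b := 2 * π) (fun θ : ℝ => Complex.I *
      ((circleMap 0 1 θ) ^ (- -k) * h (circleMap 0 1 θ)))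
  rw [neg_zero] at h2
  rw [← h2]
  refine intervalIntegral.integral_congr fun θ _ => ?_
  have h3 : circleMap 0 1 (-θ) = (circleMap 0 1 θ)⁻¹ := by
    simp [circleMap, Complex.exp_neg]
  simp only [h3, hs _ (circleMap_ne_center one_ne_zero : circleMap 0 1 θ ≠ 0), inv_zpow', neg_neg]

/-- The integrand is holomorphic off $0$, so the contour can be moved from $|z|=1$ to $|z|=|p|$; the
substitution $z\mapsto pz$ and quasi-periodicity then bring it back. -/
theorem laurent_add_two_mul {p : ℂ} (hp0 : p ≠ 0) (hp1 : ‖p‖ < 1) {n : ℕ} {h : ℂ → ℂ}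
    (hh : IsThetaOne p n h) (k : ℤ) :
    laurent h (k + 2 * n) = p ^ (k + n) * laurent h k := by
  have hd : DifferentiableOn ℂ (fun z => z ^ (-k - 1) * h z) {0}ᶜ := fun z hz =>
    (differentiableAt_zpow.2 (.inl hz)).differentiableWithinAt.mul (hh.holomorphic z hz)
  have ho : IsOpen ({0}ᶜ : Set ℂ) := isOpen_compl_singleton
  have hpn : 0 < ‖p‖ := norm_pos_iff.2 hp0
  have h1 : laurent h k = ∮ z in C(0, ‖p‖), z ^ (-k - 1) * h z := by
    refine Complex.circleIntegral_eq_of_differentiable_on_annulus_off_countable hpn hp1.le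
      Set.countable_empty (hd.continuousOn.mono ?_) fun z hz =>
        hd.differentiableAt (ho.mem_nhds ?_)
    · rintro z ⟨_, hz⟩ rfl
      exact hz (by simpa using hp0)
    · rintro rfl
      exact hz.1.2 (by simp)
  rw [h1, circleIntegral_norm_eq_smul, laurent, ← mul_assoc,
    ← circleIntegral.integral_const_mul]
  refine circleIntegral.integral_congr zero_le_one fun z hz => ?_
  have hz0 : z ≠ 0 := by rintro rfl; simp at hz
  simp only [hh.quasiPeriodic z hz0, mul_zpow]
  have e1 : z ^ (-(k + 2 * n) - 1 : ℤ) = z ^ (-k - 1) * (z ^ (2 * n))⁻¹ := by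
    rw [← zpow_natCast z, ← zpow_neg, ← zpow_add₀ hz0]; congr 1; push_cast; ring
  have e2 : p ^ (k + n) * p * (p ^ (-k - 1) * (p ^ n)⁻¹) = 1 := by
    rw [← zpow_natCast p n, ← zpow_neg, ← zpow_add₀ hp0, ← zpow_add_one₀ hp0, ← zpow_add₀ hp0,
      show k + n + 1 + (-k - 1 + -n) = 0 by ring, zpow_zero]
  rw [e1]
  have hz2 : z ^ (2 * n) ≠ 0 := pow_ne_zero _ hz0
  calc z ^ (-k - 1) * (z ^ (2 * n))⁻¹ * h z
      = (p ^ (k + n) * p * (p ^ (-k - 1) * (p ^ n)⁻¹)) *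
          (z ^ (-k - 1) * (z ^ (2 * n))⁻¹ * h z) := by rw [e2, one_mul]
    _ = _ := by rw [one_div, mul_inv]; ring

theorem laurent_eq_zero {p : ℂ} (hp0 : p ≠ 0) (hp1 : ‖p‖ < 1) {n : ℕ} {h : ℂ → ℂ}
    (hh : IsThetaOne p n h) (h0 : ∀ k : ℕ, k ≤ n → laurent h k = 0) (k : ℤ) :
    laurent h k = 0 := by
  suffices H : ∀ N : ℕ, laurent h N = 0 by
    rcases Int.natAbs_eq k with hk | hk
    · rw [hk]; exact H _
    · rw [hk, laurent_neg hh.symmetric]; exact H _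
  intro N
  induction N using Nat.strong_induction_on with
  | _ N ih =>
    rcases le_or_gt N n with hN | hN
    · exact h0 N hN
    -- For $n=0$ the recurrence does not move the index; it reads $a_N=p^Na_N$, and $p^N\ne1$. For
    -- $0<n<N$ it leads to the smaller index $|N-2n|$.
    rcases Nat.eq_zero_or_pos n with rfl | hn
    · have h1 := laurent_add_two_mul hp0 hp1 hh N
      simp only [Nat.cast_zero, mul_zero, add_zero, zpow_natCast] at h1
      have h2 : p ^ N ≠ 1 := by
        intro h3
        have := pow_lt_one₀ (norm_nonneg p) hp1 hN.ne'
        rw [← norm_pow, h3] at this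
        simp at this
      have h4 : (p ^ N - 1) * laurent h N = 0 := by linear_combination -h1
      exact (mul_eq_zero.1 h4).resolve_left (sub_ne_zero.2 h2)
    · have h1 := laurent_add_two_mul hp0 hp1 hh (N - 2 * n)
      rw [sub_add_cancel] at h1
      rw [h1]
      have h2 : laurent h ((N : ℤ) - 2 * n) = 0 := by
        rcases Int.natAbs_eq ((N : ℤ) - 2 * n) with hk | hk
        · rw [hk]; exact ih _ (by omega)
        · rw [hk, laurent_neg hh.symmetric]; exact ih _ (by omega)
      rw [h2, mul_zero]

/-- On the unit circle these are the Fourier coefficients up to a constant. A continuous function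
with summable Fourier coefficients is the sum of its series, so $h$ vanishes on the circle, and the
identity theorem does the rest. -/
theorem eq_zero_of_laurent_eq_zero {h : ℂ → ℂ} (hh : DifferentiableOn ℂ h {0}ᶜ)
    (h0 : ∀ k, laurent h k = 0) {z : ℂ} (hz : z ≠ 0) : h z = 0 := by
  have ho : IsOpen ({0}ᶜ : Set ℂ) := isOpen_compl_singleton
  have : Fact (0 < 2 * π) := ⟨Real.two_pi_pos⟩
  let f : C(AddCircle (2 * π), ℂ) := ⟨fun x => h (AddCircle.toCircle x), by
    refine hh.continuousOn.comp_continuous (by fun_prop) fun x => ?_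
    simp⟩
  have hmap : ∀ x : ℝ, ((AddCircle.toCircle (x : AddCircle (2 * π)) : Circle) : ℂ) =
      circleMap 0 1 x := by
    intro x
    rw [AddCircle.toCircle_apply_mk, Circle.coe_exp, circleMap]
    simp
  have hf : ∀ k, fourierCoeff f k = 0 := by
    intro k
    rw [fourierCoeff_eq_intervalIntegral f k 0, zero_add]
    have h1 := h0 k
    rw [laurent, circleIntegral] at h1
    have h2 : (∫ x in (0 : ℝ)..2 * π, Complex.I * (fourier (-k) (x : AddCircle (2 * π)) • f x)) =
        0 := by
      rw [← h1]
      refine intervalIntegral.integral_congr fun θ _ => ?_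
      have h0 : circleMap 0 1 θ ≠ 0 := circleMap_ne_center one_ne_zero
      have h3 : (fourier (-k) (θ : AddCircle (2 * π)) : ℂ) = circleMap 0 1 θ ^ (-k) := by
        rw [fourier_apply, AddCircle.toCircle_zsmul, Circle.coe_zpow, hmap]
      simp only [deriv_circleMap, smul_eq_mul, h3, f, ContinuousMap.coe_mk, hmap,
        zpow_sub_one₀ h0]
      field_simp
    rw [intervalIntegral.integral_const_mul] at h2
    rw [(mul_eq_zero.1 h2).resolve_left Complex.I_ne_zero, smul_zero]
  have hf0 : ∀ x, f x = 0 := by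
    intro x
    have h1 : Summable (fourierCoeff f) := by
      rw [show fourierCoeff f = fun _ => 0 from funext hf]; exact summable_zero
    have h2 := has_pointwise_sum_fourier_series_of_summable h1 x
    simp only [hf, zero_smul] at h2
    exact h2.unique hasSum_zero
  have hcirc : ∀ x : ℝ, h (circleMap 0 1 x) = 0 := fun x => by
    rw [← hmap]; exact hf0 x
  have hne : circleMap 0 1 0 ≠ 0 := circleMap_ne_center one_ne_zero
  have ht : Tendsto (circleMap 0 1) (𝓝[≠] 0) (𝓝[≠] (circleMap 0 1 0)) :=
    (hasDerivAt_circleMap 0 1 0).tendsto_nhdsNE (mul_ne_zero hne Complex.I_ne_zero)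
  have hfr : ∃ᶠ w in 𝓝[≠] (circleMap 0 1 0), h w = 0 :=
    ht.frequently (Eventually.of_forall hcirc).frequently
  exact (hh.analyticOnNhd ho).eqOn_zero_of_preconnected_of_frequently_eq_zero
    isPreconnected_compl_zero hne hfr hz

/-! ### Algebra of theta functions and shifted factorials -/

namespace IsThetaOne

variable {p : ℂ} {n n' : ℕ} {h h' : ℂ → ℂ}

theorem mul (hh : IsThetaOne p n h) (hh' : IsThetaOne p n' h') :
    IsThetaOne p (n + n') fun z => h z * h' z where
  holomorphic := hh.holomorphic.mul hh'.holomorphic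
  symmetric z hz := by rw [hh.symmetric z hz, hh'.symmetric z hz]
  quasiPeriodic z hz := by
    rw [hh.quasiPeriodic z hz, hh'.quasiPeriodic z hz, mul_add, pow_add, pow_add]
    simp only [one_div, mul_inv]
    ring

theorem const_mul (hh : IsThetaOne p n h) (r : ℂ) : IsThetaOne p n fun z => r * h z where
  holomorphic := hh.holomorphic.const_mul r
  symmetric z hz := by rw [hh.symmetric z hz]
  quasiPeriodic z hz := by rw [hh.quasiPeriodic z hz]; ring

theorem sub (hh : IsThetaOne p n h) (hh' : IsThetaOne p n h') :
    IsThetaOne p n fun z => h z - h' z where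
  holomorphic := hh.holomorphic.sub hh'.holomorphic
  symmetric z hz := by rw [hh.symmetric z hz, hh'.symmetric z hz]
  quasiPeriodic z hz := by rw [hh.quasiPeriodic z hz, hh'.quasiPeriodic z hz]; ring

theorem sum {ι : Type*} {s : Finset ι} {B : ι → ℂ → ℂ} (hB : ∀ i ∈ s, IsThetaOne p n (B i)) :
    IsThetaOne p n fun z => ∑ i ∈ s, B i z where
  holomorphic := DifferentiableOn.fun_sum fun i hi => (hB i hi).holomorphic
  symmetric z hz := Finset.sum_congr rfl fun i hi => (hB i hi).symmetric z hz
  quasiPeriodic z hz := by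
    rw [Finset.mul_sum]
    exact Finset.sum_congr rfl fun i hi => (hB i hi).quasiPeriodic z hz

theorem one : IsThetaOne p 0 fun _ => 1 where
  holomorphic := differentiableOn_const 1
  symmetric _ _ := rfl
  quasiPeriodic _ _ := by simp

end IsThetaOne

theorem isThetaOne_theta_mul_theta {p : ℂ} (hp0 : p ≠ 0) (hp1 : ‖p‖ < 1) {α : ℂ} (hα : α ≠ 0) :
    IsThetaOne p 1 fun z => theta p (α * z) * theta p (α / z) where
  holomorphic := by
    refine ((differentiableOn_theta hp1).comp (by fun_prop) fun t ht => mul_ne_zero hα ht).mul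
      ((differentiableOn_theta hp1).comp ?_ fun t ht => div_ne_zero hα ht)
    intro t ht
    exact ((differentiableAt_const α).div differentiableAt_id ht).differentiableWithinAt
  symmetric z hz := by rw [div_inv_eq_mul, mul_comm, div_eq_mul_inv]
  quasiPeriodic z hz := by
    have h1 : theta p (α * (p * z)) = -(α * z)⁻¹ * theta p (α * z) := by
      rw [← theta_mul_p hp0 hp1 (mul_ne_zero hα hz)]; congr 1; ring
    have h2 : theta p (α / z) = -(α / (p * z))⁻¹ * theta p (α / (p * z)) := by
      rw [← theta_mul_p hp0 hp1 (div_ne_zero hα (mul_ne_zero hp0 hz))]; congr 1; field_simp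
    rw [h1, h2, mul_one]
    field_simp

theorem thetaFac_zero (q p x : ℂ) : thetaFac q p x 0 = 1 := by simp [thetaFac]

theorem thetaFac₂_zero (q p x z : ℂ) : thetaFac₂ q p x z 0 = 1 := by
  simp [thetaFac₂, thetaFac_zero]

theorem thetaFac_add (q p x : ℂ) (k l : ℕ) :
    thetaFac q p x (k + l) = thetaFac q p x k * thetaFac q p (x * q ^ k) l := by
  simp only [thetaFac, Finset.prod_range_add, pow_add, mul_assoc]

theorem thetaFac_one (q p x : ℂ) : thetaFac q p x 1 = theta p x := by simp [thetaFac]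

theorem thetaFac_succ (q p x : ℂ) (k : ℕ) :
    thetaFac q p x (k + 1) = thetaFac q p x k * theta p (x * q ^ k) := by
  rw [thetaFac_add, thetaFac_one]

theorem thetaFac_succ' (q p x : ℂ) (k : ℕ) :
    thetaFac q p x (k + 1) = theta p x * thetaFac q p (x * q) k := by
  rw [add_comm, thetaFac_add, thetaFac_one, pow_one]

theorem thetaFac₂_add (q p x z : ℂ) (k l : ℕ) :
    thetaFac₂ q p x z (k + l) = thetaFac₂ q p x z k * thetaFac₂ q p (x * q ^ k) z l := by
  simp only [thetaFac₂, thetaFac_add]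
  rw [mul_right_comm x z, div_mul_eq_mul_div x z]
  ring

theorem thetaFac₂_succ' (q p x z : ℂ) (k : ℕ) :
    thetaFac₂ q p x z (k + 1) =
      theta p (x * z) * theta p (x / z) * thetaFac₂ q p (x * q) z k := by
  rw [add_comm, thetaFac₂_add, pow_one]
  simp [thetaFac₂, thetaFac_one]

theorem isThetaOne_thetaFac₂ {p q : ℂ} (hp0 : p ≠ 0) (hp1 : ‖p‖ < 1) (hq : q ≠ 0) {x : ℂ}
    (hx : x ≠ 0) (k : ℕ) : IsThetaOne p k fun z => thetaFac₂ q p x z k := by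
  induction k generalizing x with
  | zero => simpa only [thetaFac₂_zero] using IsThetaOne.one
  | succ k ih =>
    simp only [thetaFac₂_succ']
    rw [add_comm k 1]
    exact (isThetaOne_theta_mul_theta hp0 hp1 hx).mul (ih (mul_ne_zero hx hq))

theorem circleIntegrable_zpow_mul {h : ℂ → ℂ} (hh : DifferentiableOn ℂ h {0}ᶜ) (k : ℤ) :
    CircleIntegrable (fun z => z ^ k * h z) 0 1 := by
  have hs : Metric.sphere (0 : ℂ) 1 ⊆ {0}ᶜ := by
    rintro z hz rfl; simp at hz
  refine ContinuousOn.circleIntegrable zero_le_one (ContinuousOn.mul ?_ (hh.continuousOn.mono hs))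
  exact fun z hz => (continuousAt_zpow₀ z k (.inl (hs hz))).continuousWithinAt

theorem laurent_sub {h h' : ℂ → ℂ} (hh : DifferentiableOn ℂ h {0}ᶜ)
    (hh' : DifferentiableOn ℂ h' {0}ᶜ) (k : ℤ) :
    laurent (fun z => h z - h' z) k = laurent h k - laurent h' k := by
  simp only [laurent, mul_sub]
  exact circleIntegral.integral_sub (circleIntegrable_zpow_mul hh _)
    (circleIntegrable_zpow_mul hh' _)

theorem laurent_sum_mul {ι : Type*} {s : Finset ι} {B : ι → ℂ → ℂ} (β : ι → ℂ)
    (hB : ∀ i ∈ s, DifferentiableOn ℂ (B i) {0}ᶜ) (k : ℤ) :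
    laurent (fun z => ∑ i ∈ s, β i * B i z) k = ∑ i ∈ s, β i * laurent (B i) k := by
  simp only [laurent, Finset.mul_sum]
  rw [circleIntegral.integral_fun_sum]
  · refine Finset.sum_congr rfl fun i hi => ?_
    rw [← circleIntegral.integral_const_mul]
    simp only [mul_left_comm]
  · exact fun i hi => circleIntegrable_zpow_mul ((hB i hi).const_mul _) _

/-- The Laurent coefficients of index $0,\dots,n$ embed the theta functions of degree $n$ into
$\mathbb C^{n+1}$, where $n+1$ independent vectors already span. -/
theorem IsThetaOne.exists_eq_sum {p : ℂ} (hp0 : p ≠ 0) (hp1 : ‖p‖ < 1) {n : ℕ}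
    {B : Fin (n + 1) → ℂ → ℂ} (hB : ∀ k, IsThetaOne p n (B k))
    (hind : ∀ β : Fin (n + 1) → ℂ, (∀ z, z ≠ 0 → ∑ k, β k * B k z = 0) → β = 0)
    {h : ℂ → ℂ} (hh : IsThetaOne p n h) :
    ∃ β : Fin (n + 1) → ℂ, ∀ z, z ≠ 0 → h z = ∑ k, β k * B k z := by
  have hsum : ∀ β : Fin (n + 1) → ℂ, IsThetaOne p n fun z => ∑ k, β k * B k z := fun β =>
    IsThetaOne.sum fun k _ => (hB k).const_mul (β k)
  have hzero : ∀ {g : ℂ → ℂ}, IsThetaOne p n g → (∀ k : Fin (n + 1), laurent g (k : ℕ) = 0) →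
      ∀ z, z ≠ 0 → g z = 0 := fun hg h0 z hz =>
    eq_zero_of_laurent_eq_zero hg.holomorphic
      (laurent_eq_zero hp0 hp1 hg fun k hk => h0 ⟨k, by omega⟩) hz
  let v : (ℂ → ℂ) → Fin (n + 1) → ℂ := fun g i => laurent g (i : ℕ)
  have hli : LinearIndependent ℂ fun k => v (B k) := by
    rw [Fintype.linearIndependent_iff]
    intro β hβ
    refine congr_fun (hind β (hzero (hsum β) fun i => ?_))
    rw [laurent_sum_mul _ fun k _ => (hB k).holomorphic]
    simpa [v] using congr_fun hβ i
  have htop := hli.span_eq_top_of_card_eq_finrank (by simp)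
  obtain ⟨β, hβ⟩ := (Submodule.mem_span_range_iff_exists_fun ℂ).1
    (htop ▸ Submodule.mem_top : v h ∈ Submodule.span ℂ (Set.range fun k => v (B k)))
  refine ⟨β, fun z hz => sub_eq_zero.1 (hzero (hh.sub (hsum β)) (fun i => ?_) z hz)⟩
  rw [laurent_sub hh.holomorphic (hsum β).holomorphic,
    laurent_sum_mul _ fun k _ => (hB k).holomorphic, sub_eq_zero]
  simpa [v] using (congr_fun hβ i).symm

/-- Coordinates with respect to linearly independent functions are finite combinations of
evaluations. -/
theorem exists_evaluation_dual {X ι : Type*} [Finite ι] [DecidableEq ι] {B : ι → X → ℂ}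
    (hind : LinearIndependent ℂ B) (k : ι) :
    ∃ m : X →₀ ℂ, ∀ l, (m.sum fun x r => r * B l x) = if l = k then 1 else 0 := by
  have := Fintype.ofFinite ι
  -- If the evaluation vectors did not span, a nonzero functional vanishing on all of them would be
  -- a linear relation among the `B l`.
  have htop : Submodule.span ℂ (Set.range fun (x : X) (l : ι) => B l x) = ⊤ := by
    by_contra hne
    obtain ⟨φ, hφ0, hφ⟩ := Submodule.exists_le_ker_of_lt_top _ (lt_top_iff_ne_top.2 hne)
    refine hφ0 (LinearMap.pi_ext' fun l => LinearMap.ext_ring ?_)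
    rw [Fintype.linearIndependent_iff] at hind
    refine hind (fun l => φ (Pi.single l 1)) ?_ l
    ext x
    have h1 : φ (fun l => B l x) = 0 := hφ (Submodule.subset_span ⟨x, rfl⟩)
    have h2 : ∀ l, (fun j => if l = j then 1 else 0) = (Pi.single l 1 : ι → ℂ) := fun l => by
      ext j; simp [Pi.single_apply, eq_comm]
    rw [LinearMap.pi_apply_eq_sum_univ] at h1
    simpa [h2, mul_comm] using h1
  obtain ⟨m, hm⟩ := Finsupp.mem_span_range_iff_exists_finsupp.1
    (htop ▸ Submodule.mem_top : (Pi.single k 1 : ι → ℂ) ∈ Submodule.span ℂ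
      (Set.range fun (x : X) (l : ι) => B l x))
  refine ⟨m, fun l => ?_⟩
  have := congr_fun hm l
  simpa [Finsupp.sum, Pi.single_apply] using this

/-! ### Weierstrass's addition formula -/

theorem theta_div_comm {p : ℂ} (hp1 : ‖p‖ < 1) {x y : ℂ} (hx : x ≠ 0) (hy : y ≠ 0) :
    theta p (x / y) = -(x / y) * theta p (y / x) := by
  have := theta_inv hp1 (div_ne_zero hy hx)
  rwa [inv_div] at this

/-- As functions of $x$, all three terms lie in the two-dimensional space of degree one. For generic
$v$ the functions belonging to $y$ and $v$ form a basis, and setting $x=v$ and $x=y$ gives the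
coefficients. Continuity in $v$ removes the genericity. -/
theorem theta_addition {p : ℂ} (hp0 : p ≠ 0) (hp1 : ‖p‖ < 1) {x y u v : ℂ} (hx : x ≠ 0)
    (hy : y ≠ 0) (hu : u ≠ 0) (hv : v ≠ 0) :
    theta p (y * v) * theta p (y / v) * (theta p (u * x) * theta p (u / x)) =
      theta p (u * v) * theta p (u / v) * (theta p (y * x) * theta p (y / x)) -
        y / v * (theta p (u * y) * theta p (u / y)) * (theta p (v * x) * theta p (v / x)) := by
  have hT := fun {α : ℂ} (hα : α ≠ 0) => isThetaOne_theta_mul_theta hp0 hp1 hα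
  have hcv : ContinuousOn (fun v => theta p (v * x) * theta p (v / x)) {0}ᶜ := by
    refine ContinuousOn.mul ?_ ?_
    · exact (differentiableOn_theta hp1).continuousOn.comp (by fun_prop)
        fun t ht => mul_ne_zero ht hx
    · exact (differentiableOn_theta hp1).continuousOn.comp (by fun_prop)
        fun t ht => div_ne_zero ht hx
  refine ((openDense_theta_mul hp1 hy).inter (openDense_theta_div hp1 hy)).eqOn_of_continuousOn
    (F := fun v => theta p (y * v) * theta p (y / v) * (theta p (u * x) * theta p (u / x)))
    (G := fun v => theta p (u * v) * theta p (u / v) * (theta p (y * x) * theta p (y / x)) -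
        y / v * (theta p (u * y) * theta p (u / y)) * (theta p (v * x) * theta p (v / x)))
    ((hT hy).holomorphic.continuousOn.mul continuousOn_const)
    (((hT hu).holomorphic.continuousOn.mul continuousOn_const).sub
      ((ContinuousOn.mul ?_ continuousOn_const).mul hcv)) ?_ hv
  · exact continuousOn_const.div continuousOn_id fun t ht => ht
  rintro v ⟨⟨hv, h1⟩, -, h2⟩ -
  have hvy : theta p (v / y) = -(v / y) * theta p (y / v) := theta_div_comm hp1 hv hy
  have hone : ∀ {t : ℂ}, t ≠ 0 → theta p (t / t) = 0 := fun ht => by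
    rw [div_self ht, theta_one hp1]
  obtain ⟨β, hβ⟩ := (hT hu).exists_eq_sum hp0 hp1
    (B := ![fun z => theta p (y * z) * theta p (y / z), fun z => theta p (v * z) * theta p (v / z)])
    (by intro k; fin_cases k; exacts [hT hy, hT hv]) (by
      intro β hβ
      replace hβ : ∀ z, z ≠ 0 → β 0 * (theta p (y * z) * theta p (y / z)) +
          β 1 * (theta p (v * z) * theta p (v / z)) = 0 := fun z hz => by
        simpa [Fin.sum_univ_succ] using hβ z hz
      have e1 := hβ v hv
      have e2 := hβ y hy
      rw [hone hv] at e1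
      rw [hone hy, hvy, mul_comm v y] at e2
      ext k; fin_cases k
      · simpa [h1, h2] using e1
      · simpa [h1, h2, hv, hy] using e2)
  replace hβ : ∀ z, z ≠ 0 → theta p (u * z) * theta p (u / z) =
      β 0 * (theta p (y * z) * theta p (y / z)) +
        β 1 * (theta p (v * z) * theta p (v / z)) := fun z hz => by
    simpa [Fin.sum_univ_succ] using hβ z hz
  have e1 := hβ v hv
  have e2 := hβ y hy
  rw [hone hv] at e1
  rw [hone hy, hvy, mul_comm v y] at e2
  rw [hβ x hx, e1, e2]
  field_simp
  ring

/-! ### The basis adapted to $a$ and $c$ -/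

/-- The basis `(a z, a / z; q, p)_k (c q^k z, c q^k / z; q, p)_{n - k}` of the space of theta
functions of degree `n`. -/
noncomputable def thetaBasis (q p a c : ℂ) (n k : ℕ) (z : ℂ) : ℂ :=
  thetaFac₂ q p a z k * thetaFac₂ q p (c * q ^ k) z (n - k)

theorem isThetaOne_thetaBasis {p q : ℂ} (hp0 : p ≠ 0) (hp1 : ‖p‖ < 1) (hq : q ≠ 0) {a c : ℂ}
    (ha : a ≠ 0) (hc : c ≠ 0) {n k : ℕ} (hk : k ≤ n) :
    IsThetaOne p n (thetaBasis q p a c n k) := by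
  have := (isThetaOne_thetaFac₂ hp0 hp1 hq ha k).mul
    (isThetaOne_thetaFac₂ hp0 hp1 hq (mul_ne_zero hc (pow_ne_zero k hq)) (n - k))
  rwa [Nat.add_sub_cancel' hk] at this

theorem thetaBasis_succ (q p a c : ℂ) (n k : ℕ) (z : ℂ) :
    thetaBasis q p a c (n + 1) (k + 1) z =
      theta p (a * z) * theta p (a / z) * thetaBasis q p (a * q) (c * q) n k z := by
  rw [thetaBasis, thetaBasis, thetaFac₂_succ', Nat.add_sub_add_right, pow_succ', mul_assoc,
    mul_assoc c]

/-- At $z=a$ only the member $k=0$ survives, so its coefficient is zero. The others share the factor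
$\theta(az)\theta(a/z)$; dividing by it leaves the basis for $(aq,cq)$ and degree $n-1$. Then $ac$
becomes $acq^2$, which is why the range of $e$ shrinks by two. -/
theorem thetaBasis_independent {p q : ℂ} (hp0 : p ≠ 0) (hp1 : ‖p‖ < 1) (hq : q ≠ 0) {n : ℕ} :
    ∀ {a c : ℂ}, a ≠ 0 → c ≠ 0 → (∀ j < n, theta p (c / a * q ^ j) ≠ 0) →
    (∀ e, e + 2 ≤ 2 * n → theta p (a * c * q ^ e) ≠ 0) →
    ∀ β : Fin (n + 1) → ℂ,
      (∀ z, z ≠ 0 → ∑ k : Fin (n + 1), β k * thetaBasis q p a c n k z = 0) → β = 0 := by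
  induction n with
  | zero =>
    intro a c ha hc _ _ β hβ
    ext k
    have := hβ 1 one_ne_zero
    simpa [Fin.fin_one_eq_zero k, thetaBasis, thetaFac₂_zero] using this
  | succ n ih =>
    intro a c ha hc hca hac β hβ
    simp only [Fin.sum_univ_succ (n := n + 1), Fin.val_zero, Fin.val_succ, thetaBasis_succ] at hβ
    have h0 : β 0 = 0 := by
      have h1 := hβ a ha
      simp only [div_self ha, theta_one hp1, mul_zero, zero_mul, Finset.sum_const_zero,
        add_zero] at h1
      refine (mul_eq_zero.1 h1).resolve_right ?_
      rw [thetaBasis, thetaFac₂_zero, one_mul, thetaFac₂]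
      simp only [thetaFac, pow_zero, mul_one, Nat.sub_zero]
      refine mul_ne_zero (Finset.prod_ne_zero_iff.2 fun j hj => ?_)
        (Finset.prod_ne_zero_iff.2 fun j hj => hca j (Finset.mem_range.1 hj))
      rw [mul_comm c a]
      exact hac j (by have := Finset.mem_range.1 hj; omega)
    simp only [h0, zero_mul, zero_add] at hβ
    have haq := mul_ne_zero ha hq
    have hcq := mul_ne_zero hc hq
    have h1 : (fun k : Fin (n + 1) => β k.succ) = 0 := by
      refine ih haq hcq (fun j hj => ?_) (fun e he => ?_) _ fun z hz => ?_
      · rw [mul_div_mul_right _ _ hq]; exact hca j (by omega)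
      · have := hac (e + 2) (by omega)
        rwa [show a * c * q ^ (e + 2) = a * q * (c * q) * q ^ e by ring] at this
      · refine ((openDense_theta_mul hp1 ha).inter (openDense_theta_div hp1 ha)).eqOn_of_continuousOn
          (F := fun z => ∑ k : Fin (n + 1), β k.succ * thetaBasis q p (a * q) (c * q) n k z)
          (G := fun _ => 0) ?_ continuousOn_const ?_ hz
        · exact (IsThetaOne.sum fun (k : Fin (n + 1)) _ =>
            (isThetaOne_thetaBasis hp0 hp1 hq haq hcq (Nat.lt_succ_iff.1 k.2)).const_mul
              (β k.succ)).holomorphic.continuousOn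
        · rintro t ⟨⟨-, h1⟩, -, h2⟩ ht
          have h3 := hβ t ht
          have h4 : theta p (a * t) * theta p (a / t) *
              ∑ k : Fin (n + 1), β k.succ * thetaBasis q p (a * q) (c * q) n k t = 0 := by
            rw [← h3, Finset.mul_sum]
            exact Finset.sum_congr rfl fun k _ => by ring
          exact (mul_eq_zero.1 h4).resolve_left (mul_ne_zero h1 h2)
    ext k
    refine Fin.cases h0 (fun k => congr_fun h1 k) k

/-- Evaluation functionals dual to `thetaBasis`. -/
theorem exists_thetaBasis_expansion {p q : ℂ} (hp0 : p ≠ 0) (hp1 : ‖p‖ < 1) (hq : q ≠ 0) {n : ℕ}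
    {a c : ℂ} (ha : a ≠ 0) (hc : c ≠ 0) (hca : ∀ j < n, theta p (c / a * q ^ j) ≠ 0)
    (hac : ∀ e, e + 2 ≤ 2 * n → theta p (a * c * q ^ e) ≠ 0) :
    ∃ M : Fin (n + 1) → ℂˣ →₀ ℂ, ∀ h : ℂ → ℂ, IsThetaOne p n h → ∀ z, z ≠ 0 →
      h z = ∑ k, ((M k).sum fun x r => r * h x) * thetaBasis q p a c n k z := by
  have hind := thetaBasis_independent hp0 hp1 hq ha hc hca hac
  have hB : ∀ k : Fin (n + 1), IsThetaOne p n (thetaBasis q p a c n k) := fun k =>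
    isThetaOne_thetaBasis hp0 hp1 hq ha hc (Nat.lt_succ_iff.1 k.2)
  have hli : LinearIndependent ℂ
      fun (k : Fin (n + 1)) (x : ℂˣ) => thetaBasis q p a c n k (x : ℂ) := by
    rw [Fintype.linearIndependent_iff]
    intro β hβ
    refine congr_fun (hind β fun z hz => ?_)
    simpa using congr_fun hβ (Units.mk0 z hz)
  choose M hM using exists_evaluation_dual hli
  refine ⟨M, fun h hh z hz => ?_⟩
  obtain ⟨β, hβ⟩ := hh.exists_eq_sum hp0 hp1 hB hind
  rw [hβ z hz]
  refine Finset.sum_congr rfl fun k _ => ?_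
  congr 1
  have : ∀ (x : ℂˣ) (r : ℂ), r * h x = ∑ l, β l * (r * thetaBasis q p a c n l (x : ℂ)) := by
    intro x r
    rw [hβ x x.ne_zero, Finset.mul_sum]
    exact Finset.sum_congr rfl fun l _ => by ring
  simp only [this, Finsupp.sum]
  rw [Finset.sum_comm]
  simp only [← Finset.mul_sum]
  have h2 := fun l => hM k l
  simp only [Finsupp.sum] at h2
  simp [h2]

/-! ### Expansion in several variables -/

theorem IsThetaFunction.isThetaOne_update {m : ℕ} {p : ℂ} {k : Fin m → ℕ} {g : (Fin m → ℂ) → ℂ}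
    (hg : IsThetaFunction p k g) {z : Fin m → ℂ} (hz : ∀ i, z i ≠ 0) (i : Fin m) :
    IsThetaOne p (k i) fun t => g (Function.update z i t) := by
  have hne : ∀ t : ℂ, t ≠ 0 → ∀ l, Function.update z i t l ≠ 0 := by
    intro t ht l
    rcases eq_or_ne l i with rfl | hl
    · simpa using ht
    · simpa [hl] using hz l
  refine ⟨?_, fun t ht => ?_, fun t ht => ?_⟩
  · refine hg.holomorphic.comp (fun t _ => ?_) fun t ht => hne t ht
    exact (hasFDerivAt_update z t).differentiableAt.differentiableWithinAt
  · simpa using hg.symmetric _ (hne t ht) i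
  · simpa using hg.quasiPeriodic _ (hne t ht) i

/-- Coefficients in one variable are finite combinations of evaluations, so expanding a variable
merely freezes it at finitely many points. What remains is still $g$, and no regularity of
coefficients in the other variables has to be proved. -/
theorem IsThetaFunction.mem_span_prod_thetaBasis {m : ℕ} {p q : ℂ} (hp0 : p ≠ 0) (hp1 : ‖p‖ < 1)
    (hq : q ≠ 0) {a c : Fin m → ℂ} (ha : ∀ i, a i ≠ 0) (hc : ∀ i, c i ≠ 0) {k : Fin m → ℕ}
    (hca : ∀ i, ∀ j < k i, theta p (c i / a i * q ^ j) ≠ 0)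
    (hac : ∀ i, ∀ e, e + 2 ≤ 2 * k i → theta p (a i * c i * q ^ e) ≠ 0)
    {g : (Fin m → ℂ) → ℂ} (hg : IsThetaFunction p k g) :
    (fun u : Fin m → ℂˣ => g fun i => u i) ∈ Submodule.span ℂ
      (Set.range fun (K : ∀ i, Fin (k i + 1)) (u : Fin m → ℂˣ) =>
        ∏ i, thetaBasis q p (a i) (c i) (k i) (K i) (u i)) := by
  classical
  choose M hM using fun i => exists_thetaBasis_expansion hp0 hp1 hq (ha i) (hc i) (hca i) (hac i)
  -- Variables in `S` are already expanded, and inside $g$ they are frozen at the values of `y`; the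
  -- others are still free.
  have key : ∀ S : Finset (Fin m), (fun u : Fin m → ℂˣ => g fun i => u i) ∈ Submodule.span ℂ
      (Set.range fun (Ky : (∀ i, Fin (k i + 1)) × (Fin m → ℂˣ)) (u : Fin m → ℂˣ) =>
        (∏ i ∈ S, thetaBasis q p (a i) (c i) (k i) (Ky.1 i) (u i)) *
          g fun i => S.piecewise Ky.2 u i) := by
    intro S
    induction S using Finset.induction_on with
    | empty => exact Submodule.subset_span ⟨(fun _ => 0, 1), by simp⟩
    | insert i S hi ih =>
      refine Submodule.span_le.2 ?_ ih
      rintro _ ⟨⟨K, y⟩, rfl⟩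
      have h1 : (fun u : Fin m → ℂˣ =>
          (∏ i ∈ S, thetaBasis q p (a i) (c i) (k i) (K i) (u i)) *
            g fun i => S.piecewise y u i) =
          ∑ l : Fin (k i + 1), ∑ x ∈ (M i l).support, (M i l x) •
            fun u : Fin m → ℂˣ => (∏ j ∈ insert i S,
              thetaBasis q p (a j) (c j) (k j) (Function.update K i l j) (u j)) *
            g fun j => (insert i S).piecewise (Function.update y i x) u j := by
        ext u
        have hw : ∀ j, ((S.piecewise y u j : ℂˣ) : ℂ) ≠ 0 := fun j => Units.ne_zero _
        have h2 := hM i _ (hg.isThetaOne_update hw i) (u i) (u i).ne_zero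
        have h3 : Function.update (fun j => ((S.piecewise y u j : ℂˣ) : ℂ)) i (u i : ℂ) =
            fun j => ((S.piecewise y u j : ℂˣ) : ℂ) := by
          rw [Function.update_eq_self_iff]; simp [hi]
        rw [h3] at h2
        simp only [h2, Finsupp.sum, Finset.mul_sum, Finset.sum_mul, Finset.sum_apply,
          Pi.smul_apply, smul_eq_mul]
        refine Finset.sum_congr rfl fun l _ => Finset.sum_congr rfl fun x _ => ?_
        have h4 : (fun j => (((insert i S).piecewise (Function.update y i x) u j : ℂˣ) : ℂ)) =
            Function.update (fun j => ((S.piecewise y u j : ℂˣ) : ℂ)) i (x : ℂ) := by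
          ext j
          rcases eq_or_ne j i with rfl | hj
          · simp
          · by_cases hjS : j ∈ S <;> simp [hj, hjS]
        have h5 : ∏ j ∈ S, thetaBasis q p (a j) (c j) (k j) (Function.update K i l j) (u j) =
            ∏ j ∈ S, thetaBasis q p (a j) (c j) (k j) (K j) (u j) :=
          Finset.prod_congr rfl fun j hj => by
            rw [Function.update_of_ne (ne_of_mem_of_not_mem hj hi)]
        rw [Finset.prod_insert hi, h4, h5, Function.update_self]
        ring
      simp only [SetLike.mem_coe]
      rw [h1]
      exact Submodule.sum_mem _ fun l _ => Submodule.sum_mem _ fun x _ =>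
        Submodule.smul_mem _ _ (Submodule.subset_span
          ⟨(Function.update K i l, Function.update y i x), rfl⟩)
  refine Submodule.span_le.2 ?_ (key Finset.univ)
  rintro _ ⟨⟨K, y⟩, rfl⟩
  have h1 : (fun u : Fin m → ℂˣ =>
      (∏ i, thetaBasis q p (a i) (c i) (k i) (K i) (u i)) *
        g fun i => (Finset.univ : Finset (Fin m)).piecewise y u i) =
      (g fun i => y i) • fun u : Fin m → ℂˣ =>
        ∏ i, thetaBasis q p (a i) (c i) (k i) (K i) (u i) := by
    ext u
    simp [mul_comm]
  simp only [SetLike.mem_coe]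
  rw [h1]
  exact Submodule.smul_mem _ _ (Submodule.subset_span ⟨K, rfl⟩)

/-- Since $(cz,c/z)_k=(cz,c/z)_K(cq^Kz,cq^K/z)_{k-K}$, a basis element over its denominator is a
ratio that depends on $K$ but not on the degree $k$. All generators of `W` thus share one spanning
family. -/
theorem exists_expansion_of_mem_W {m : ℕ} {p q : ℂ} (hp0 : p ≠ 0) (hp1 : ‖p‖ < 1)
    (hq : q ≠ 0) {a c : Fin m → ℂ} (ha : ∀ i, a i ≠ 0) (hc : ∀ i, c i ≠ 0) {n : Fin m → ℕ}
    (hca : ∀ i, ∀ j < n i, theta p (c i / a i * q ^ j) ≠ 0)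
    (hac : ∀ i, ∀ e, e + 2 ≤ 2 * n i → theta p (a i * c i * q ^ e) ≠ 0)
    {f : (Fin m → ℂ) → ℂ} (hf : f ∈ W q p c n) :
    ∃ β : (Fin m → ℕ) → ℂ, ∀ z : Fin m → ℂ, (∀ i, z i ≠ 0) →
      (∀ i, thetaFac₂ q p (c i) (z i) (n i) ≠ 0) →
      f z = ∑ K ∈ Fintype.piFinset (fun i => Finset.range (n i + 1)),
        β K * ∏ i, thetaFac₂ q p (a i) (z i) (K i) / thetaFac₂ q p (c i) (z i) (K i) := by
  let X := {z : Fin m → ℂ // (∀ i, z i ≠ 0) ∧ ∀ i, thetaFac₂ q p (c i) (z i) (n i) ≠ 0}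
  let Φ : (Fin m → ℕ) → X → ℂ := fun K z =>
    ∏ i, thetaFac₂ q p (a i) (z.1 i) (K i) / thetaFac₂ q p (c i) (z.1 i) (K i)
  let s := Fintype.piFinset fun i => Finset.range (n i + 1)
  suffices h : (fun z : X => f z.1) ∈ Submodule.span ℂ (Φ '' s) by
    obtain ⟨β, hβ⟩ := Submodule.mem_span_image_finset_iff_exists_fun' ℂ |>.1 h
    refine ⟨β, fun z hz hz' => ?_⟩
    simpa [Φ] using (congr_fun hβ ⟨z, hz, hz'⟩).symm
  rw [W] at hf
  induction hf using Submodule.span_induction with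
  | zero => exact Submodule.zero_mem _
  | add f f' _ _ h h' => exact Submodule.add_mem _ h h'
  | smul r f _ h => exact Submodule.smul_mem _ r h
  | mem f hf =>
    obtain ⟨k, hk, g, hg, rfl⟩ := hf
    have h1 := hg.mem_span_prod_thetaBasis hp0 hp1 hq ha hc
      (fun i j hj => hca i j (hj.trans_le (hk i)))
      (fun i e he => hac i e (he.trans (by have := hk i; omega)))
    obtain ⟨γ, hγ⟩ := (Submodule.mem_span_range_iff_exists_fun ℂ).1 h1
    have h2 : (fun z : X => g z.1 / ∏ i, thetaFac₂ q p (c i) (z.1 i) (k i)) =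
        ∑ K, γ K • Φ fun i => K i := by
      ext ⟨z, hz, hz'⟩
      have h3 := congr_fun hγ fun i => Units.mk0 (z i) (hz i)
      simp only [Finset.sum_apply, Pi.smul_apply, smul_eq_mul, Units.val_mk0] at h3
      simp only [Finset.sum_apply, Pi.smul_apply, smul_eq_mul, ← h3, Finset.sum_div, Φ]
      refine Finset.sum_congr rfl fun K _ => ?_
      rw [mul_div_assoc, ← Finset.prod_div_distrib]
      congr 1
      refine Finset.prod_congr rfl fun i _ => ?_
      have h4 := thetaFac₂_add q p (c i) (z i) (K i) (k i - K i)
      rw [Nat.add_sub_cancel' (Nat.lt_succ_iff.1 (K i).2)] at h4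
      have h5 := thetaFac₂_add q p (c i) (z i) (k i) (n i - k i)
      rw [Nat.add_sub_cancel' (hk i)] at h5
      have h6 : thetaFac₂ q p (c i) (z i) (k i) ≠ 0 := left_ne_zero_of_mul (h5 ▸ hz' i)
      have h7 := right_ne_zero_of_mul (h4 ▸ h6)
      rw [h4, thetaBasis, mul_div_mul_right _ _ h7]
    rw [h2]
    refine Submodule.sum_mem _ fun K _ => Submodule.smul_mem _ _
      (Submodule.subset_span ⟨_, ?_, rfl⟩)
    simp only [s, Finset.mem_coe, Fintype.mem_piFinset, Finset.mem_range]
    intro i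
    have := (K i).2
    have := hk i
    omega

/-! ### Separation of variables for the operators -/

/-- The one-variable elliptic Askey–Wilson operator. -/
noncomputable def awOne (s p c : ℂ) (φ : ℂ → ℂ) : ℂ → ℂ := fun t =>
  2 * s * t *
    (theta p (c * t * s⁻¹) * theta p (c * t * s) * theta p (c * s⁻¹ / t) * theta p (c * s / t)) /
    (theta p (s ^ 2) * theta p (t ^ 2)) * (φ (s * t) - φ (s⁻¹ * t))

/-- The iterates of the one-variable operators. -/
noncomputable def awOneIter (s p c : ℂ) : ℕ → (ℂ → ℂ) → ℂ → ℂ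
  | 0, φ => φ
  | k + 1, φ => awOne s p (c * s ^ (3 * k)) (awOneIter s p c k φ)

section Separable

variable {m : ℕ} {ι : Type*} (T : Finset ι) (β : ι → ℂ) (s p : ℂ)

theorem awOp_sum_prod (c : ℂ) (i : Fin m) (φ : ι → Fin m → ℂ → ℂ) :
    awOp s p c i (fun z => ∑ J ∈ T, β J * ∏ l, φ J l (z l)) = fun z =>
      ∑ J ∈ T, β J * ∏ l, Function.update (φ J) i (awOne s p c (φ J i)) l (z l) := by
  have hupd : ∀ (ψ : Fin m → ℂ → ℂ) (χ : ℂ → ℂ) (z : Fin m → ℂ) (t : ℂ),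
      ∏ l, Function.update ψ i χ l (Function.update z i t l) =
        χ t * ∏ l ∈ Finset.univ.erase i, ψ l (z l) := by
    intro ψ χ z t
    rw [← Finset.mul_prod_erase _ _ (Finset.mem_univ i)]
    congr 1
    · simp
    · refine Finset.prod_congr rfl fun l hl => ?_
      have := Finset.ne_of_mem_erase hl
      simp [this]
  ext z
  have h1 : ∀ J t, ∏ l, φ J l (Function.update z i t l) =
      φ J i t * ∏ l ∈ Finset.univ.erase i, φ J l (z l) := fun J t => by
    rw [← hupd, Function.update_eq_self]
  have h2 : ∀ J, ∏ l, Function.update (φ J) i (awOne s p c (φ J i)) l (z l) =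
      awOne s p c (φ J i) (z i) * ∏ l ∈ Finset.univ.erase i, φ J l (z l) := fun J => by
    rw [← hupd, Function.update_eq_self]
  simp only [awOp, h1, h2, awOne, ← Finset.sum_sub_distrib, Finset.mul_sum]
  exact Finset.sum_congr rfl fun J _ => by ring

theorem awIter_sum_prod (c : ℂ) (i : Fin m) (k : ℕ) (φ : ι → Fin m → ℂ → ℂ) :
    awIter s p c i k (fun z => ∑ J ∈ T, β J * ∏ l, φ J l (z l)) = fun z =>
      ∑ J ∈ T, β J * ∏ l, Function.update (φ J) i (awOneIter s p c k (φ J i)) l (z l) := by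
  induction k with
  | zero => simp [awIter, awOneIter]
  | succ k ih =>
    rw [awIter, ih, awOp_sum_prod]
    simp [awOneIter]

theorem foldr_awIter_sum_prod (c : Fin m → ℂ) (k : Fin m → ℕ) (φ : ι → Fin m → ℂ → ℂ)
    {L : List (Fin m)} (hL : L.Nodup) :
    L.foldr (fun i F => awIter s p (c i) i (k i) F)
        (fun z => ∑ J ∈ T, β J * ∏ l, φ J l (z l)) = fun z =>
      ∑ J ∈ T, β J * ∏ l,
        (if l ∈ L then awOneIter s p (c l) (k l) (φ J l) else φ J l) (z l) := by
  induction L with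
  | nil => simp
  | cons i L ih =>
    rw [List.nodup_cons] at hL
    rw [List.foldr_cons, ih hL.2,
      awIter_sum_prod T β s p (c i) i (k i)
        (fun J l => if l ∈ L then awOneIter s p (c l) (k l) (φ J l) else φ J l)]
    ext z
    refine Finset.sum_congr rfl fun J _ => ?_
    congr 1
    refine Finset.prod_congr rfl fun l _ => ?_
    rcases eq_or_ne l i with rfl | hl
    · simp [hL.1]
    · simp [hl]

theorem awMulti_sum_prod (c : Fin m → ℂ) (k : Fin m → ℕ) (φ : ι → Fin m → ℂ → ℂ) :
    awMulti s p c k (fun z => ∑ J ∈ T, β J * ∏ l, φ J l (z l)) = fun z =>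
      ∑ J ∈ T, β J * ∏ l, awOneIter s p (c l) (k l) (φ J l) (z l) := by
  rw [awMulti, foldr_awIter_sum_prod T β s p c k φ (List.nodup_finRange m)]
  simp

end Separable

/-! ### Generic equality is preserved by the operators -/

/-- Equality on a product of open dense subsets of `ℂ`. -/
def BoxAgree {m : ℕ} (f g : (Fin m → ℂ) → ℂ) : Prop :=
  ∃ E : Fin m → Set ℂ, (∀ i, OpenDense (E i)) ∧ ∀ z, (∀ i, z i ∈ E i) → f z = g z

theorem OpenDense.inter_shifts {E : Set ℂ} (hE : OpenDense E) {s : ℂ} (hs : s ≠ 0) :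
    OpenDense (E ∩ ({t | s * t ∈ E} ∩ {t | s⁻¹ * t ∈ E})) :=
  hE.inter ((hE.preimage_mul hs).inter (hE.preimage_mul (inv_ne_zero hs)))

theorem BoxAgree.awOp {m : ℕ} {f g : (Fin m → ℂ) → ℂ} (h : BoxAgree f g) {s : ℂ} (hs : s ≠ 0)
    (p c : ℂ) (i : Fin m) : BoxAgree (awOp s p c i f) (awOp s p c i g) := by
  obtain ⟨E, hE, hfg⟩ := h
  refine ⟨_, fun l => (hE l).inter_shifts hs, fun z hz => ?_⟩
  have key : ∀ t, t ∈ E i → f (Function.update z i t) = g (Function.update z i t) := by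
    intro t ht
    refine hfg _ fun l => ?_
    rcases eq_or_ne l i with rfl | hl
    · simpa using ht
    · simpa [hl] using (hz l).1
  rw [EllipticTaylor.awOp, EllipticTaylor.awOp, key _ (hz i).2.1, key _ (hz i).2.2]

theorem BoxAgree.awIter {m : ℕ} {f g : (Fin m → ℂ) → ℂ} (h : BoxAgree f g) {s : ℂ} (hs : s ≠ 0)
    (p c : ℂ) (i : Fin m) (k : ℕ) : BoxAgree (awIter s p c i k f) (awIter s p c i k g) := by
  induction k with
  | zero => exact h
  | succ k ih => exact ih.awOp hs p _ i

theorem BoxAgree.awMulti {m : ℕ} {f g : (Fin m → ℂ) → ℂ} (h : BoxAgree f g) {s : ℂ} (hs : s ≠ 0)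
    (p : ℂ) (c : Fin m → ℂ) (k : Fin m → ℕ) : BoxAgree (awMulti s p c k f) (awMulti s p c k g) := by
  unfold EllipticTaylor.awMulti
  induction List.finRange m with
  | nil => exact h
  | cons i L ih => exact ih.awIter hs p (c i) i (k i)

/-- Equality on an open dense subset of `ℂ`. -/
def GenericEq (φ ψ : ℂ → ℂ) : Prop := ∃ E : Set ℂ, OpenDense E ∧ ∀ t ∈ E, φ t = ψ t

theorem GenericEq.trans {φ ψ χ : ℂ → ℂ} (h : GenericEq φ ψ) (h' : GenericEq ψ χ) :
    GenericEq φ χ := by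
  obtain ⟨E, hE, h⟩ := h
  obtain ⟨E', hE', h'⟩ := h'
  exact ⟨_, hE.inter hE', fun t ht => (h t ht.1).trans (h' t ht.2)⟩

theorem GenericEq.awOne {φ ψ : ℂ → ℂ} (h : GenericEq φ ψ) {s : ℂ} (hs : s ≠ 0) (p c : ℂ) :
    GenericEq (awOne s p c φ) (awOne s p c ψ) := by
  obtain ⟨E, hE, h⟩ := h
  refine ⟨_, hE.inter_shifts hs, fun t ht => ?_⟩
  rw [EllipticTaylor.awOne, EllipticTaylor.awOne, h _ ht.2.1, h _ ht.2.2]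

theorem openDense_thetaFac₂ {p q : ℂ} (hp1 : ‖p‖ < 1) (hq : q ≠ 0) {x : ℂ} (hx : x ≠ 0) (k : ℕ) :
    OpenDense {t | t ≠ 0 ∧ thetaFac₂ q p x t k ≠ 0} := by
  induction k generalizing x with
  | zero =>
    simp only [thetaFac₂_zero, ne_eq, one_ne_zero, not_false_eq_true, and_true]
    exact ⟨isOpen_compl_singleton, dense_compl_singleton 0⟩
  | succ k ih =>
    have := ((openDense_theta_mul hp1 hx).inter (openDense_theta_div hp1 hx)).inter
      (ih (mul_ne_zero hx hq))
    convert! this using 1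
    ext t
    simp only [thetaFac₂_succ', Set.mem_inter_iff, Set.mem_ofPred_eq, mul_ne_zero_iff]
    tauto

/-! ### Action of the operators on the ratios -/

theorem theta_quartic {p : ℂ} (hp0 : p ≠ 0) (hp1 : ‖p‖ < 1) {s a c t : ℂ} (hs : s ≠ 0)
    (ha : a ≠ 0) (hc : c ≠ 0) (ht : t ≠ 0) (j : ℕ) :
    theta p (c * t * s⁻¹) * theta p (c * s / t * (s ^ 2) ^ j) *
        theta p (a * s * t * (s ^ 2) ^ j) * theta p (a * s⁻¹ / t) -
      theta p (c * s⁻¹ / t) * theta p (c * s * t * (s ^ 2) ^ j) *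
        theta p (a * t * s⁻¹) * theta p (a * s / t * (s ^ 2) ^ j) =
    -(a / (s * t)) * (theta p ((s ^ 2) ^ (j + 1)) * theta p (c / a) *
      theta p (a * c * (s ^ 2) ^ j) * theta p (t ^ 2)) := by
  obtain ⟨ρ, hρ⟩ := IsAlgClosed.exists_pow_nat_eq (a / c) two_pos
  have hρ0 : ρ ≠ 0 := by
    rintro rfl
    exact div_ne_zero ha hc (by rw [← hρ]; simp)
  have ha' : a = c * ρ ^ 2 := by rw [hρ]; field_simp
  have hsj : s ^ j ≠ 0 := pow_ne_zero j hs
  have hsj' : s ^ (j + 1) ≠ 0 := pow_ne_zero _ hs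
  -- With $\rho^2=a/c$, the products and quotients of these four parameters are the required theta
  -- arguments, four of them inverted; `f1` to `f4` undo the inversions.
  have key := theta_addition hp0 hp1 (x := t * c * ρ * s ^ j) (y := s ^ (j + 1) * ρ)
    (u := c * ρ * s ^ j / t) (v := s ^ (j + 1) / ρ)
    (by positivity) (by positivity) (by positivity) (by positivity)
  have f1 : theta p (s ^ (j + 1) * ρ / (t * c * ρ * s ^ j)) =
      -(s / (c * t)) * theta p (c * t * s⁻¹) := by
    rw [show s ^ (j + 1) * ρ / (t * c * ρ * s ^ j) = s / (c * t) by
      field_simp; ring,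
      theta_div_comm hp1 hs (by positivity), ← div_eq_mul_inv]
  have f2 : theta p (s ^ (j + 1) / ρ / (t * c * ρ * s ^ j)) =
      -(s / (a * t)) * theta p (a * t * s⁻¹) := by
    rw [show s ^ (j + 1) / ρ / (t * c * ρ * s ^ j) = s / (a * t) by
      rw [ha']; field_simp; ring,
      theta_div_comm hp1 hs (by positivity), ← div_eq_mul_inv]
  have f3 : theta p (s ^ (j + 1) * ρ / (s ^ (j + 1) / ρ)) = -(a / c) * theta p (c / a) := by
    rw [show s ^ (j + 1) * ρ / (s ^ (j + 1) / ρ) = a / c by rw [ha']; field_simp,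
      theta_div_comm hp1 ha hc]
  have f4 : theta p (c * ρ * s ^ j / t / (t * c * ρ * s ^ j)) =
      -(t ^ 2)⁻¹ * theta p (t ^ 2) := by
    rw [show c * ρ * s ^ j / t / (t * c * ρ * s ^ j) = (t ^ 2)⁻¹ by field_simp,
      theta_inv hp1 (by positivity)]
  rw [f1, f2, f3, f4,
    show s ^ (j + 1) * ρ * (s ^ (j + 1) / ρ) = (s ^ 2) ^ (j + 1) by field_simp; ring,
    show c * ρ * s ^ j / t * (t * c * ρ * s ^ j) = a * c * (s ^ 2) ^ j by
      rw [ha']; field_simp; ring,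
    show c * ρ * s ^ j / t * (s ^ (j + 1) / ρ) = c * s / t * (s ^ 2) ^ j by
      field_simp; ring,
    show c * ρ * s ^ j / t / (s ^ (j + 1) / ρ) = a * s⁻¹ / t by rw [ha']; field_simp; ring,
    show s ^ (j + 1) * ρ * (t * c * ρ * s ^ j) = a * s * t * (s ^ 2) ^ j by rw [ha']; ring,
    show s ^ (j + 1) * ρ / (s ^ (j + 1) / ρ) = a / c by rw [ha']; field_simp,
    show c * ρ * s ^ j / t * (s ^ (j + 1) * ρ) = a * s / t * (s ^ 2) ^ j by
      rw [ha']; field_simp; ring,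
    show c * ρ * s ^ j / t / (s ^ (j + 1) * ρ) = c * s⁻¹ / t by field_simp; ring,
    show s ^ (j + 1) / ρ * (t * c * ρ * s ^ j) = c * s * t * (s ^ 2) ^ j by
      field_simp; ring] at key
  refine Eq.trans ?_ ((congrArg (fun w => -(c * t / s) * w) key.symm).trans ?_)
  · field_simp
    ring
  · field_simp

/-- The quotient `(a t, a / t; q, p)_j / (c t, c / t; q, p)_j` with `q = s ^ 2`. -/
noncomputable def thetaRatio (s p a c : ℂ) (j : ℕ) (t : ℂ) : ℂ :=
  thetaFac₂ (s ^ 2) p a t j / thetaFac₂ (s ^ 2) p c t j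

/-- The two shifted ratios share the numerator $(ast,as/t)_j$. The theta factors of the operator
fill the gaps in their denominators, leaving $(cs^3t,cs^3/t)_j$ in both. The remaining difference is
`theta_quartic`, whose factor $\theta(t^2)$ cancels the one in the operator; $\theta(q)$ is never
cancelled. -/
theorem awOne_thetaRatio {p : ℂ} (hp0 : p ≠ 0) (hp1 : ‖p‖ < 1) {s a c : ℂ} (hs : s ≠ 0)
    (ha : a ≠ 0) (hc : c ≠ 0) (j : ℕ) :
    GenericEq (awOne s p c (thetaRatio s p a c (j + 1))) fun t =>
      -2 * a * (theta p ((s ^ 2) ^ (j + 1)) * theta p (c / a) * theta p (a * c * (s ^ 2) ^ j)) /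
        theta p (s ^ 2) * thetaRatio s p (a * s) (c * s ^ 3) j t := by
  have hq : s ^ 2 ≠ 0 := pow_ne_zero 2 hs
  refine ⟨_, (openDense_theta_sq hp1).inter
    (((openDense_thetaFac₂ hp1 hq hc (j + 1)).preimage_mul hs).inter
      ((openDense_thetaFac₂ hp1 hq hc (j + 1)).preimage_mul (inv_ne_zero hs))), ?_⟩
  rintro t ⟨⟨ht, htt⟩, ⟨-, h1⟩, -, h2⟩
  have key := theta_quartic hp0 hp1 hs ha hc ht j
  have aux : ∀ x : ℂ,
      thetaFac (s ^ 2) p (x * (s * t)) (j + 1) =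
        thetaFac (s ^ 2) p (x * s * t) (j + 1) ∧
      thetaFac (s ^ 2) p (x / (s * t)) (j + 1) =
        theta p (x * s⁻¹ / t) * thetaFac (s ^ 2) p (x * s / t) j ∧
      thetaFac (s ^ 2) p (x * (s⁻¹ * t)) (j + 1) =
        theta p (x * t * s⁻¹) * thetaFac (s ^ 2) p (x * s * t) j ∧
      thetaFac (s ^ 2) p (x / (s⁻¹ * t)) (j + 1) =
        thetaFac (s ^ 2) p (x * s / t) (j + 1) := by
    intro x
    have e1 : x / (s * t) = x * s⁻¹ / t := by field_simp
    have e2 : x / (s⁻¹ * t) = x * s / t := by field_simp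
    have e3 : x * s⁻¹ / t * s ^ 2 = x * s / t := by field_simp
    have e4 : x * t * s⁻¹ * s ^ 2 = x * s * t := by field_simp
    refine ⟨by rw [mul_assoc], ?_, ?_, by rw [e2]⟩
    · rw [e1, thetaFac_succ', e3]
    · rw [show x * (s⁻¹ * t) = x * t * s⁻¹ by ring, thetaFac_succ', e4]
  obtain ⟨a1, a2, a3, a4⟩ := aux a
  obtain ⟨c1, c2, c3, c4⟩ := aux c
  have F1 := thetaFac_succ' (s ^ 2) p (c * s * t) j
  have F2 := thetaFac_succ' (s ^ 2) p (c * s / t) j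
  rw [show c * s * t * s ^ 2 = c * s ^ 3 * t by ring] at F1
  rw [show c * s / t * s ^ 2 = c * s ^ 3 / t by ring] at F2
  have G1 := thetaFac_succ (s ^ 2) p (c * s * t) j
  have G2 := thetaFac_succ (s ^ 2) p (c * s / t) j
  have hA1 := thetaFac_succ (s ^ 2) p (a * s * t) j
  have hA2 := thetaFac_succ (s ^ 2) p (a * s / t) j
  simp only [thetaFac₂, c1, c2, c3, c4, mul_ne_zero_iff] at h1 h2
  simp only [awOne, thetaRatio, thetaFac₂, a1, a2, a3, a4, c1, c2, c3, c4, hA1, hA2]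
  clear hA1 hA2 a1 a2 a3 a4 c1 c2 c3 c4 aux
  obtain ⟨n1, n2, n3⟩ := h1
  obtain ⟨⟨n4, n5⟩, n6⟩ := h2
  -- `G1` and `G2` now equate the two ways of splitting one factor off a factorial of length $j+1$.
  -- With `key` they are the only theta relations needed; the rest is rational algebra.
  rw [F1] at n1 G1
  rw [F2] at n6 G2
  rw [F1, F2]
  generalize thetaFac (s ^ 2) p (c * s * t) j = C1 at *
  generalize thetaFac (s ^ 2) p (c * s / t) j = C2 at *
  generalize thetaFac (s ^ 2) p (a * s * t) j = A1 at *
  generalize thetaFac (s ^ 2) p (a * s / t) j = A2 at *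
  generalize thetaFac (s ^ 2) p (c * s ^ 3 * t) j = D1 at *
  generalize thetaFac (s ^ 2) p (c * s ^ 3 / t) j = D2 at *
  generalize theta p (c * s * t * (s ^ 2) ^ j) = w at *
  generalize theta p (c * s / t * (s ^ 2) ^ j) = w' at *
  rw [show c * t * s = c * s * t by ring]
  generalize theta p (c * s * t) = x1 at *
  generalize theta p (c * s / t) = x2 at *
  generalize theta p (c * s⁻¹ / t) = x3 at *
  generalize theta p (c * t * s⁻¹) = x4 at *
  generalize theta p (a * s * t * (s ^ 2) ^ j) = y1 at *
  generalize theta p (a * s / t * (s ^ 2) ^ j) = y2 at *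
  generalize theta p (a * s⁻¹ / t) = y3 at *
  generalize theta p (a * t * s⁻¹) = y4 at *
  generalize theta p ((s ^ 2) ^ (j + 1)) = z1 at *
  generalize theta p (c / a) = z2 at *
  generalize theta p (a * c * (s ^ 2) ^ j) = z3 at *
  generalize theta p (t ^ 2) = z4 at *
  obtain ⟨nx1, nD1⟩ := mul_ne_zero_iff.1 n1
  obtain ⟨nx2, nD2⟩ := mul_ne_zero_iff.1 n6
  have B1 : A1 * y1 * (y3 * A2) / (x1 * D1 * (x3 * C2)) * (x4 * x1 * x3 * x2) =
      A1 * A2 / (D1 * D2) * (x4 * w' * y1 * y3) := by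
    field_simp
    linear_combination (A1 * A2 * y1 * y3) * G2
  have B2 : y4 * A1 * (A2 * y2) / (x4 * C1 * (x2 * D2)) * (x4 * x1 * x3 * x2) =
      A1 * A2 / (D1 * D2) * (x3 * w * y4 * y2) := by
    field_simp
    linear_combination (A1 * A2 * y4 * y2) * G1
  calc _ = 2 * s * t / (theta p (s ^ 2) * z4) *
        (A1 * y1 * (y3 * A2) / (x1 * D1 * (x3 * C2)) * (x4 * x1 * x3 * x2) -
          y4 * A1 * (A2 * y2) / (x4 * C1 * (x2 * D2)) * (x4 * x1 * x3 * x2)) := by ring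
    _ = 2 * s * t / (theta p (s ^ 2) * z4) * (A1 * A2 / (D1 * D2) *
          (-(a / (s * t)) * (z1 * z2 * z3 * z4))) := by rw [B1, B2, ← mul_sub, key]
    _ = 2 * (s * t * (a / (s * t))) * (z4 / z4) * (A1 * A2 / (D1 * D2)) * (-(z1 * z2 * z3)) /
          theta p (s ^ 2) := by
      rw [mul_comm (theta p (s ^ 2)), ← div_div]; ring
    _ = _ := by rw [div_self htt, mul_div_cancel₀ _ (mul_ne_zero hs ht)]; ring

/-- The scalar relating `𝓓^{(k)}` of `thetaRatio s p a c (l + k)` to a `thetaRatio` of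
order `l`. -/
noncomputable def ratioCoeff (s p a c : ℂ) (k l : ℕ) : ℂ :=
  (-2 * a) ^ k * s ^ k.choose 2 * (thetaFac (s ^ 2) p ((s ^ 2) ^ (l + 1)) k *
    thetaFac (s ^ 2) p (c / a) k *
      thetaFac (s ^ 2) p (a * c * (s ^ 2) ^ ((l + k : ℤ) - 1)) k) / theta p (s ^ 2) ^ k

/-- The new step has parameters $as^k$ and $cs^{3k}$, with quotient $(c/a)q^k$ and product
$acq^{2k}$. Its theta factors lengthen the first factorial at the front and the other two at the
end. -/
theorem ratioCoeff_succ {s p a c : ℂ} (hs : s ≠ 0) (k l : ℕ) :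
    ratioCoeff s p a c (k + 1) l = ratioCoeff s p a c k (l + 1) *
      (-2 * (a * s ^ k) * (theta p ((s ^ 2) ^ (l + 1)) * theta p (c * s ^ (3 * k) / (a * s ^ k)) *
        theta p (a * s ^ k * (c * s ^ (3 * k)) * (s ^ 2) ^ l)) / theta p (s ^ 2)) := by
  have hq : s ^ 2 ≠ 0 := pow_ne_zero 2 hs
  have e1 : c * s ^ (3 * k) / (a * s ^ k) = c / a * (s ^ 2) ^ k := by
    rw [mul_div_mul_comm, show 3 * k = 2 * k + k by ring, pow_add,
      mul_div_cancel_right₀ _ (pow_ne_zero k hs), pow_mul]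
  have e2 : a * c * (s ^ 2) ^ (((l : ℤ) + 1 + k) - 1) * (s ^ 2) ^ k =
      a * s ^ k * (c * s ^ (3 * k)) * (s ^ 2) ^ l := by
    rw [show ((l : ℤ) + 1 + k) - 1 = ((l + k : ℕ) : ℤ) by push_cast; ring, zpow_natCast]
    ring
  rw [ratioCoeff, ratioCoeff, thetaFac_succ' _ _ ((s ^ 2) ^ (l + 1)), thetaFac_succ _ _ (c / a), e1,
    show ((l : ℤ) + ((k + 1 : ℕ) : ℤ)) - 1 = (((l + 1 : ℕ) : ℤ) + k) - 1 by push_cast; ring,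
    thetaFac_succ _ _ (a * c * _), Nat.cast_succ, e2, Nat.choose_succ_succ' k 1, Nat.choose_one_right,
    ← pow_succ (s ^ 2)]
  simp only [pow_succ _ k, pow_add s k, one_add_one_eq_two, div_eq_mul_inv, mul_inv]
  ring

theorem awOneIter_thetaRatio {p : ℂ} (hp0 : p ≠ 0) (hp1 : ‖p‖ < 1) {s a c : ℂ} (hs : s ≠ 0)
    (ha : a ≠ 0) (hc : c ≠ 0) (k l : ℕ) :
    GenericEq (awOneIter s p c k (thetaRatio s p a c (l + k))) fun t =>
      ratioCoeff s p a c k l * thetaRatio s p (a * s ^ k) (c * s ^ (3 * k)) l t := by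
  induction k generalizing l with
  | zero => exact ⟨_, openDense_univ, fun t _ => by simp [awOneIter, ratioCoeff, thetaFac_zero]⟩
  | succ k ih =>
    have h1 := (ih (l + 1)).awOne hs p (c * s ^ (3 * k))
    obtain ⟨E, hE, h2⟩ := awOne_thetaRatio hp0 hp1 hs (mul_ne_zero ha (pow_ne_zero k hs))
      (mul_ne_zero hc (pow_ne_zero (3 * k) hs)) l
    rw [show l + (k + 1) = l + 1 + k by ring]
    refine h1.trans ⟨E, hE, fun t ht => ?_⟩
    have h3 : ∀ (r : ℂ) (d : ℂ) (φ : ℂ → ℂ),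
        awOne s p d (fun t => r * φ t) t = r * awOne s p d φ t := fun r d φ => by
      simp only [awOne]; ring
    rw [h3, h2 t ht, ratioCoeff_succ hs, show 3 * (k + 1) = 3 * k + 3 by ring, pow_succ s k,
      pow_add s (3 * k), ← mul_assoc a, ← mul_assoc c]
    ring

/-- After $j$ steps the ratio of order $j$ is generically constant, and the next difference kills
it. -/
theorem awOneIter_thetaRatio_of_lt {p : ℂ} (hp0 : p ≠ 0) (hp1 : ‖p‖ < 1) {s a c : ℂ} (hs : s ≠ 0)
    (ha : a ≠ 0) (hc : c ≠ 0) {j k : ℕ} (hjk : j < k) :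
    GenericEq (awOneIter s p c k (thetaRatio s p a c j)) fun _ => 0 := by
  have hconst : ∀ (φ : ℂ → ℂ) (r d : ℂ), GenericEq φ (fun _ => r) →
      GenericEq (awOne s p d φ) fun _ => 0 := fun φ r d h =>
    (h.awOne hs p d).trans ⟨_, openDense_univ, fun t _ => by simp [awOne]⟩
  induction k, hjk using Nat.le_induction with
  | base =>
    have h := awOneIter_thetaRatio hp0 hp1 hs ha hc j 0
    rw [zero_add] at h
    exact hconst _ (ratioCoeff s p a c j 0) _ (by simpa [thetaRatio, thetaFac₂_zero] using h)
  | succ k _ ih => exact hconst _ 0 _ ih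

theorem inv_taylorFactor (s p a c : ℂ) (k : ℕ) :
    (taylorFactor s p a c k)⁻¹ = ratioCoeff s p a c k 0 := by
  have h : ((-1 : ℂ) ^ k)⁻¹ = (-1) ^ k := by
    rw [← inv_pow]; norm_num
  rw [taylorFactor, ratioCoeff, inv_div, div_eq_mul_inv, mul_inv, mul_inv, h, inv_inv, zero_add,
    pow_one, Nat.cast_zero, zero_add, neg_mul, neg_eq_neg_one_mul (2 * a), mul_pow (-1)]
  ring

/-- The iterated one-variable operators applied to `thetaRatio`, as analytic functions, and their
values at `a s^k`. -/
theorem exists_analyticAt_awOneIter_thetaRatio {p : ℂ} (hp0 : p ≠ 0) (hp1 : ‖p‖ < 1) {s a c : ℂ}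
    (hs : s ≠ 0) (ha : a ≠ 0) (hc : c ≠ 0) {n : ℕ}
    (hca : ∀ i < n, theta p (c / a * (s ^ 2) ^ i) ≠ 0)
    (hac : ∀ e, e + 2 ≤ 2 * n → theta p (a * c * (s ^ 2) ^ e) ≠ 0) {j k : ℕ} (hj : j ≤ n) :
    ∃ G : ℂ → ℂ, GenericEq (awOneIter s p c k (thetaRatio s p a c j)) G ∧
      AnalyticAt ℂ G (a * s ^ k) ∧
      G (a * s ^ k) = if j = k then (taylorFactor s p a c k)⁻¹ else 0 := by
  rcases lt_or_ge j k with hjk | hjk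
  · exact ⟨_, awOneIter_thetaRatio_of_lt hp0 hp1 hs ha hc hjk, analyticAt_const, by simp [hjk.ne]⟩
  obtain ⟨l, rfl⟩ := Nat.exists_eq_add_of_le' hjk
  have hq : s ^ 2 ≠ 0 := pow_ne_zero 2 hs
  have hk : a * s ^ k ≠ 0 := mul_ne_zero ha (pow_ne_zero k hs)
  have hck : c * s ^ (3 * k) ≠ 0 := mul_ne_zero hc (pow_ne_zero _ hs)
  have hana : ∀ {x : ℂ}, x ≠ 0 → AnalyticAt ℂ (fun t => thetaFac₂ (s ^ 2) p x t l) (a * s ^ k) :=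
    fun hx => (isThetaOne_thetaFac₂ hp0 hp1 hq hx l).holomorphic.analyticAt
      (isOpen_compl_singleton.mem_nhds hk)
  refine ⟨_, awOneIter_thetaRatio hp0 hp1 hs ha hc k l,
    analyticAt_const.mul ((hana hk).div (hana hck) ?_), ?_⟩
  · have e1 : c * s ^ (3 * k) / (a * s ^ k) = c / a * (s ^ 2) ^ k := by
      rw [mul_div_mul_comm, show 3 * k = 2 * k + k by ring, pow_add,
        mul_div_cancel_right₀ _ (pow_ne_zero k hs), pow_mul]
    rw [thetaFac₂, e1, show c * s ^ (3 * k) * (a * s ^ k) = a * c * (s ^ 2) ^ (2 * k) by ring]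
    simp only [thetaFac, mul_assoc _ _ ((s ^ 2) ^ _), ← pow_add]
    refine mul_ne_zero (Finset.prod_ne_zero_iff.2 fun i hi => ?_)
      (Finset.prod_ne_zero_iff.2 fun i hi => ?_)
    all_goals have := Finset.mem_range.1 hi
    · rw [← mul_assoc]; exact hac _ (by omega)
    · exact hca _ (by omega)
  · rcases Nat.eq_zero_or_pos l with rfl | hl
    · simp [inv_taylorFactor, thetaRatio, thetaFac₂_zero]
    -- For positive remaining order the numerator contains $\theta(as^k/t)$, which is $\theta(1)=0$
    -- at $t=as^k$.
    · obtain ⟨l, rfl⟩ := Nat.exists_eq_add_of_le' hl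
      simp [thetaRatio, thetaFac₂_succ', div_self hk, theta_one hp1]

end EllipticTaylor

/-! ### The Taylor expansion -/

open EllipticTaylor in
theorem theorem2p8 (m : ℕ) (p q s : ℂ)
    (hp0 : p ≠ 0) (hp1 : ‖p‖ < 1) (hq0 : q ≠ 0) (hq1 : ‖q‖ < 1) (hs : s ^ 2 = q)
    (a c : Fin m → ℂ) (n : Fin m → ℕ)
    (ha : ∀ i, a i ≠ 0) (hc : ∀ i, c i ≠ 0)
    (hdq : ∀ i, ∀ k ≤ n i, EllipticTaylor.thetaFac q p q k ≠ 0)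
    (hdca : ∀ i, ∀ k ≤ n i, EllipticTaylor.thetaFac q p (c i / a i) k ≠ 0)
    (hdac : ∀ i, ∀ k ≤ n i,
      EllipticTaylor.thetaFac q p (a i * c i * q ^ ((k : ℤ) - 1)) k ≠ 0)
    (f : (Fin m → ℂ) → ℂ) (hf : f ∈ EllipticTaylor.W q p c n) :
    ∃ v : (Fin m → ℕ) → ℂ,
      (∀ k : Fin m → ℕ, (∀ i, k i ≤ n i) →
        EllipticTaylor.HasRegularValue (EllipticTaylor.awMulti s p c k f)
          (fun i => a i * s ^ k i) (v k)) ∧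
      ∀ z : Fin m → ℂ, (∀ i, z i ≠ 0) →
        (∀ i, EllipticTaylor.thetaFac₂ q p (c i) (z i) (n i) ≠ 0) →
        f z = ∑ k ∈ Fintype.piFinset (fun i => Finset.range (n i + 1)),
          ((∏ i, EllipticTaylor.taylorFactor s p (a i) (c i) (k i)) * v k) *
            ∏ i, EllipticTaylor.thetaFac₂ q p (a i) (z i) (k i) /
              EllipticTaylor.thetaFac₂ q p (c i) (z i) (k i) := by
  subst hs
  have hs0 : s ≠ 0 := by rintro rfl; simp at hq0
  have hca : ∀ i, ∀ j < n i, theta p (c i / a i * (s ^ 2) ^ j) ≠ 0 := fun i j hj =>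
    Finset.prod_ne_zero_iff.1 (hdca i (n i) le_rfl) j (Finset.mem_range.2 hj)
  have hac : ∀ i, ∀ e, e + 2 ≤ 2 * n i → theta p (a i * c i * (s ^ 2) ^ e) ≠ 0 := by
    intro i e he
    have key : ∀ k j : ℕ, j < k + 1 → k + 1 ≤ n i →
        theta p (a i * c i * (s ^ 2) ^ (k + j)) ≠ 0 := by
      intro k j hj hk
      have := Finset.prod_ne_zero_iff.1 (hdac i (k + 1) hk) j (Finset.mem_range.2 hj)
      rwa [Nat.cast_succ, add_sub_cancel_right, zpow_natCast, mul_assoc (a i * c i),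
        ← pow_add] at this
    -- The hypothesis covers exponents $k+j$ with $j\le k<n_i$; splitting $e$ into its rounded-up
    -- and rounded-down halves reaches every $e\le2n_i-2$.
    have := key ((e + 1) / 2) (e / 2) (by omega) (by omega)
    rwa [show (e + 1) / 2 + e / 2 = e by omega] at this
  have hτ : ∀ i, ∀ k ≤ n i, taylorFactor s p (a i) (c i) k ≠ 0 := by
    intro i k hk
    have hθ : theta p (s ^ 2) ^ k ≠ 0 := by
      rcases Nat.eq_zero_or_pos k with rfl | hk0
      · simp
      · have := hdq i 1 (hk0.trans_le hk)
        rw [thetaFac_one] at this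
        exact pow_ne_zero k this
    refine div_ne_zero (mul_ne_zero (mul_ne_zero (pow_ne_zero _ (by norm_num))
      (inv_ne_zero (pow_ne_zero _ hs0))) hθ) (mul_ne_zero (pow_ne_zero _
        (mul_ne_zero two_ne_zero (ha i))) (mul_ne_zero (mul_ne_zero (hdq i k hk) (hdca i k hk))
          (hdac i k hk)))
  obtain ⟨β, hβ⟩ := exists_expansion_of_mem_W hp0 hp1 hq0 ha hc hca hac hf
  -- The value is forced: multiplied by the Taylor factors it must return $\beta_k$.
  refine ⟨fun k => (∏ i, (taylorFactor s p (a i) (c i) (k i))⁻¹) * β k, fun k hk => ?_, ?_⟩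
  · set T := Fintype.piFinset fun i => Finset.range (n i + 1) with hT
    have hJ : ∀ J ∈ T, ∀ i, J i ≤ n i := fun J hJ i =>
      Nat.lt_succ_iff.1 (Finset.mem_range.1 (Fintype.mem_piFinset.1 hJ i))
    have hagree : BoxAgree f fun z => ∑ J ∈ T, β J *
        ∏ i, thetaRatio s p (a i) (c i) (J i) (z i) :=
      ⟨_, fun i => openDense_thetaFac₂ hp1 hq0 (hc i) (n i),
        fun z hz => hβ z (fun i => (hz i).1) fun i => (hz i).2⟩
    have h1 := hagree.awMulti hs0 p c k
    rw [awMulti_sum_prod T β s p c k fun J i => thetaRatio s p (a i) (c i) (J i)] at h1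
    obtain ⟨E, hE, hfE⟩ := h1
    -- The bound on `j` sits inside the existential so that `choose` yields a total family; beyond
    -- `n i` the function is a dummy.
    have hG : ∀ i j, ∃ G : ℂ → ℂ, j ≤ n i →
        GenericEq (awOneIter s p (c i) (k i) (thetaRatio s p (a i) (c i) j)) G ∧
        AnalyticAt ℂ G (a i * s ^ k i) ∧
        G (a i * s ^ k i) = if j = k i then (taylorFactor s p (a i) (c i) (k i))⁻¹ else 0 := by
      intro i j
      by_cases hj : j ≤ n i
      · obtain ⟨G, hG⟩ := exists_analyticAt_awOneIter_thetaRatio hp0 hp1 hs0 (ha i) (hc i)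
          (hca i) (hac i) (k := k i) hj
        exact ⟨G, fun _ => hG⟩
      · exact ⟨0, fun h => absurd h hj⟩
    choose G hG using hG
    have hgen : ∀ i, ∀ N ≤ n i, ∃ V : Set ℂ, OpenDense V ∧ ∀ j ≤ N, ∀ t ∈ V,
        awOneIter s p (c i) (k i) (thetaRatio s p (a i) (c i) j) t = G i j t := by
      intro i N hN
      induction N with
      | zero =>
        obtain ⟨V, hV, h⟩ := (hG i 0 hN).1
        exact ⟨V, hV, fun j hj => by rwa [Nat.le_zero.1 hj]⟩
      | succ N ih =>
        obtain ⟨V, hV, h⟩ := ih (by omega)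
        obtain ⟨V', hV', h'⟩ := (hG i (N + 1) hN).1
        refine ⟨_, hV.inter hV', fun j hj t ht => ?_⟩
        rcases Nat.le_succ_iff.1 hj with hj | rfl
        · exact h j hj t ht.1
        · exact h' t ht.2
    choose V hV hVG using fun i => hgen i (n i) le_rfl
    have hU := OpenDense.pi fun i => (hE i).inter (hV i)
    refine ⟨fun z => ∑ J ∈ T, β J * ∏ i, G i (J i) (z i), ?_, ?_, _, hU.1, hU.2, ?_⟩
    · refine Finset.analyticAt_fun_sum _ fun J hJT => analyticAt_const.mul
        (Finset.analyticAt_fun_prod _ fun i _ => ?_)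
      exact AnalyticAt.fun_comp (g := G i (J i)) (hG i (J i) (hJ J hJT i)).2.1
        ((ContinuousLinearMap.proj (R := ℂ) (φ := fun _ : Fin m => ℂ) i).analyticAt _)
    · beta_reduce
      rw [Finset.sum_eq_single k]
      · rw [mul_comm]
        congr 1
        refine Finset.prod_congr rfl fun i _ => ?_
        rw [(hG i (k i) (hk i)).2.2, if_pos rfl]
      · intro J hJT hne
        obtain ⟨i, hi⟩ := Function.ne_iff.1 hne
        rw [Finset.prod_eq_zero (Finset.mem_univ i), mul_zero]
        rw [(hG i (J i) (hJ J hJT i)).2.2, if_neg hi]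
      · intro hkT
        exact absurd (Fintype.mem_piFinset.2 fun i =>
          Finset.mem_range.2 (Nat.lt_succ_iff.2 (hk i))) hkT
    · refine .of_forall fun z hz => ?_
      rw [hfE z fun i => (hz i).1]
      refine Finset.sum_congr rfl fun J hJT => ?_
      congr 1
      exact Finset.prod_congr rfl fun i _ => hVG i (J i) (hJ J hJT i) _ (hz i).2
  · intro z hz hz'
    rw [hβ z hz hz']
    refine Finset.sum_congr rfl fun k hk => ?_
    congr 1
    rw [← mul_assoc, ← Finset.prod_mul_distrib, Finset.prod_eq_one, one_mul]
    exact fun i _ => mul_inv_cancel₀ (hτ i _ (Nat.lt_succ_iff.1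
      (Finset.mem_range.1 (Fintype.mem_piFinset.1 hk i))))
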